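/- Let $d,r\ge 2$ and $e\ge 1$ be integers. Let $B(de,e,r)$ denote the braid group of the complex reflection group $G(de,e,r)$, given by its Broué–Malle–Rouquier presentation: generators $z,t_0,t_1,s_3,\dots,s_r$; relations: the usual braid relations on $s_3,\dots,s_r$ ($s_is_j=s_js_i$ for $|i-j|>1$ and $s_js_{j+1}s_j=s_{j+1}s_js_{j+1}$), together with $zt_1t_0=t_1t_0z$; $z\langle t_1t_0\rangle^{e}=t_0z\langle t_1t_0\rangle^{e-1}$, where $\langle t_1t_0\rangle^{k}$ is the alternating product $t_1t_0t_1\cdots$ with $k$ factors; $zs_j=s_jz$ for $3\le j\le r$; $s_3t_is_3=t_is_3t_i$ for $i=0,1$; $s_3(t_1t_0)s_3(t_1t_0)=(t_1t_0)s_3(t_1t_0)s_3$; and $s_jt_i=t_is_j$ for $i=0,1$ and $4\le j\le r$. (Relations involving $s_3$ occur only if $r\ge 3$. For $d\ge 2$ the group does not depend on $d$.) Let $B(\infty,\infty,r)$ be the group with generators $t_0,t_1,s_3,\dots,s_r$ and those of the above relations that do not involve $z$. In both groups let $t_i$ ($i\in\mathbb Z$) be the elements determined by $t_0$, $t_1$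 and $t_it_{i-1}=t_1t_0$, that is, $t_{2m+k}=(t_1t_0)^mt_k(t_1t_0)^{-m}$ for $m\in\mathbb Z$ and $k\in\{0,1\}$. Let $B^+(de,e,r)$ be the monoid with generators $z$, $t_i$ ($i\in\mathbb Z$), $s_3,\dots,s_r$ and relations: the usual braid relations on $s_3,\dots,s_r$, together with - $(Q_1)$ $t_it_{i-1}=t_jt_{j-1}$ for $i,j\in\mathbb Z$; - $(Q_2)$ $s_3t_is_3=t_is_3t_i$ for $i\in\mathbb Z$; - $(Q_3)$ $s_jt_i=t_is_j$ for $i\in\mathbb Z$, $4\le j\le r$; - $(Q_4)$ $zt_i=t_{i-e}z$ for $i\in\mathbb Z$; - $(Q_5)$ $zs_j=s_jz$ for $3\le j\le r$. Let $B^+(\infty,\infty,r)$ be the monoid with generators $t_i$ ($i\in\mathbb Z$), $s_3,\dots,s_r$, the braid relations, and $(Q_1)$–$(Q_3)$. Put $A=s_rs_{r-1}\cdots s_3$ (so $A=1$ if $r=2$) and $\Lambda=(At_1t_0)^{r-1}$. Let $C_\infty=\langle c\rangle$ be an infinite cyclic group, $C_\infty^e=\langle c^e\rangle$ and $(C_\infty^e)^+=\{c^{en}\mid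 n\ge 0\}$. A monoid $M$ is *quasi-Garside* if (1) $M$ is atomic: for each $m\in M$ the number of nontrivial factors in a product equal to $m$ is bounded; (2) $M$ is left and right cancellative; (3) $M$ is a lattice both for left divisibility and for right divisibility; (4) $M$ has a *Garside element*, i.e. an element whose left divisors coincide with its right divisors, these divisors generating $M$. If $M$ is quasi-Garside with Garside element $\Delta$, and embeds in the group $G$ as a submonoid of which $G$ is the group of (left and right) fractions, then $(M,\Delta)$ is a *quasi-Garside structure* on $G$. **Theorem.** 1. The group presented by the generators and relations of $B^+(de,e,r)$ is isomorphic to $B(de,e,r)$, by $z\mapsto z$, $t_i\mapsto t_i$ ($i\in\mathbb Z$), $s_j\mapsto s_j$. 2. $C_\infty$ acts by automorphisms on the group $B(\infty,\infty,r)$ and on the monoid $B^+(\infty,\infty,r)$, in both cases with $c\cdot t_i=t_{i-1}$ ($i\in\mathbb Z$) and $c\cdot s_j=s_j$; and for these actions $z\mapsto c^e$, $t_i\mapsto t_i$, $s_j\mapsto s_j$ defines isomorphisms $$B(de,e,r)\cong C_\infty^e\ltimes B(\infty,\infty,r),\qquad B^+(de,e,r)\cong (C_\infty^e)^+\ltimes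 B^+(\infty,\infty,r).$$ 3. For all integers $p,q\ge 1$, the pair $(B^+(de,e,r),\,z^p\Lambda^q)$ is a quasi-Garside structure on $B(de,e,r)$, with respect to the homomorphism $B^+(de,e,r)\to B(de,e,r)$, $z\mapsto z$, $t_i\mapsto t_i$, $s_j\mapsto s_j$. In particular ($p=q=1$) $z\Lambda$ is a Garside element of $B^+(de,e,r)$. -/

import Mathlib

/-! ### Quasi-Garside monoids and quasi-Garside structures

In a monoid, `a ∣ b` means that `a` is a left divisor of `b` (`b = a * c` for some `c`), and
`RightDvd a b` that `a` is a right divisor of `b` (`b = c * a` for some `c`). -/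

/-- `M` is atomic: for every `m`, the number of (nontrivial) factors in a product equal to `m`
is bounded. -/
def IsAtomicMonoid (M : Type*) [Monoid M] : Prop :=
  ∀ m : M, ∃ n : ℕ, ∀ l : List M, (∀ x ∈ l, x ≠ 1) → l.prod = m → l.length ≤ n

/-- The left divisors of `Δ` are exactly its right divisors, and they generate `M`. -/
structure IsGarsideElement {M : Type*} [Monoid M] (Δ : M) : Prop where
  left_iff_right : ∀ x : M, x ∣ Δ ↔ RightDvd x Δ
  closure_eq_top : Submonoid.closure {x : M | x ∣ Δ} = ⊤

/-- Quasi-Garside monoids. -/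
structure IsQuasiGarsideMonoid (M : Type*) [Monoid M] : Prop where
  atomic : IsAtomicMonoid M
  mul_left_cancel : ∀ a b c : M, a * b = a * c → b = c
  mul_right_cancel : ∀ a b c : M, b * a = c * a → b = c
  left_lattice : ∃ L : Lattice M, ∀ a b : M, L.le a b ↔ a ∣ b
  right_lattice : ∃ L : Lattice M, ∀ a b : M, L.le a b ↔ RightDvd a b
  exists_garside : ∃ Δ : M, IsGarsideElement Δ

/-- `G` is, through `ι`, the group of (right and left) fractions of `M`. -/
structure IsGroupOfFractions {M G : Type*} [Monoid M] [Group G] (ι : M →* G) : Prop where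
  injective : Function.Injective ι
  right_fractions : ∀ g : G, ∃ a b : M, g = ι a * (ι b)⁻¹
  left_fractions : ∀ g : G, ∃ a b : M, g = (ι a)⁻¹ * ι b

/-- The pair `(M, Δ)` is a quasi-Garside structure on `G`, where `M` is identified with its
image in `G` through `ι`. -/
structure IsQuasiGarsideStructure {M G : Type*} [Monoid M] [Group G] (ι : M →* G) (Δ : M) :
    Prop where
  quasiGarside : IsQuasiGarsideMonoid M
  garside : IsGarsideElement Δ
  fractions : IsGroupOfFractions ι

/-! ### Positive presentations -/

/-- A set of positive relations `u = v` on the alphabet `α`. The monoid that it presents is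
`PresentedMonoid R`. -/
abbrev PosRel (α : Type) : Type := FreeMonoid α → FreeMonoid α → Prop

/-- The group presented by the positive relations `R`. -/
abbrev PosGroup {α : Type} (R : PosRel α) : Type :=
  PresentedGroup {w : FreeGroup α | ∃ u v : FreeMonoid α, R u v ∧
    w = FreeMonoid.lift FreeGroup.of u * (FreeMonoid.lift FreeGroup.of v)⁻¹}

/-- The image of a letter in the presented group. -/
abbrev PosGroup.gen {α : Type} (R : PosRel α) (a : α) : PosGroup R := PresentedGroup.of a

/-! ### The relations

In each family of relations the letters are passed as arguments, so that the same family can be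
used over several alphabets. The letters `s₃, …, s_r` are indexed by `SIdx r`. -/

/-- The indices `3, …, r`. -/
abbrev SIdx (r : ℕ) : Type := {j : ℕ // 3 ≤ j ∧ j ≤ r}

open FreeMonoid in
/-- The usual braid relations on `s₃, …, s_r`. -/
inductive BraidRel {α : Type} {r : ℕ} (s : SIdx r → α) : PosRel α
  | comm (j k : SIdx r) (h : (j : ℕ) + 1 < k) :
      BraidRel s (of (s j) * of (s k)) (of (s k) * of (s j))
  | braid (j k : SIdx r) (h : (k : ℕ) = j + 1) :
      BraidRel s (of (s j) * of (s k) * of (s j)) (of (s k) * of (s j) * of (s k))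

open FreeMonoid in
/-- The relations on `t₀, t₁, s₃, …, s_r` shared by Shi's presentation of `B(∞,∞,r)` and the
Broué–Malle–Rouquier presentation of `B(de,e,r)`. -/
inductive PRel {α : Type} {r : ℕ} (t₀ t₁ : α) (s : SIdx r → α) : PosRel α
  | braid (u v : FreeMonoid α) (h : BraidRel s u v) : PRel t₀ t₁ s u v
  | p2_zero (j : SIdx r) (hj : (j : ℕ) = 3) :
      PRel t₀ t₁ s (of (s j) * of t₀ * of (s j)) (of t₀ * of (s j) * of t₀)
  | p2_one (j : SIdx r) (hj : (j : ℕ) = 3) :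
      PRel t₀ t₁ s (of (s j) * of t₁ * of (s j)) (of t₁ * of (s j) * of t₁)
  | p3_zero (j : SIdx r) (hj : 4 ≤ (j : ℕ)) : PRel t₀ t₁ s (of (s j) * of t₀) (of t₀ * of (s j))
  | p3_one (j : SIdx r) (hj : 4 ≤ (j : ℕ)) : PRel t₀ t₁ s (of (s j) * of t₁) (of t₁ * of (s j))
  | p4 (j : SIdx r) (hj : (j : ℕ) = 3) :
      PRel t₀ t₁ s (of (s j) * (of t₁ * of t₀) * of (s j) * (of t₁ * of t₀))
        ((of t₁ * of t₀) * of (s j) * (of t₁ * of t₀) * of (s j))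

open FreeMonoid in
/-- The relations `(Q₁)`, `(Q₂)`, `(Q₃)` and the braid relations, on the letters
`t_i` (`i ∈ ℤ`) and `s₃, …, s_r`. -/
inductive QRel {α : Type} {r : ℕ} (t : ℤ → α) (s : SIdx r → α) : PosRel α
  | braid (u v : FreeMonoid α) (h : BraidRel s u v) : QRel t s u v
  | q1 (i j : ℤ) : QRel t s (of (t i) * of (t (i - 1))) (of (t j) * of (t (j - 1)))
  | q2 (j : SIdx r) (hj : (j : ℕ) = 3) (i : ℤ) :
      QRel t s (of (s j) * of (t i) * of (s j)) (of (t i) * of (s j) * of (t i))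
  | q3 (j : SIdx r) (hj : 4 ≤ (j : ℕ)) (i : ℤ) :
      QRel t s (of (s j) * of (t i)) (of (t i) * of (s j))

/-- The word `a b a b ⋯` with `k` letters. -/
def altWord {α : Type} (a b : α) : ℕ → FreeMonoid α
  | 0 => 1
  | k + 1 => FreeMonoid.of a * altWord b a k

/-! ### The group `B(∞,∞,r)` and the monoid `B⁺(∞,∞,r)` -/

/-- The generators of Shi's presentation. -/
inductive ShiGen (r : ℕ) : Type
  | t₀ | t₁ | s (j : SIdx r)

/-- The group `B(∞,∞,r)`. -/
abbrev BInf (r : ℕ) : Type := PosGroup (PRel (r := r) ShiGen.t₀ ShiGen.t₁ ShiGen.s)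

/-- The generators `t_i` (`i ∈ ℤ`) and `s₃, …, s_r`. -/
inductive InfGen (r : ℕ) : Type
  | t (i : ℤ) | s (j : SIdx r)

/-- The monoid `B⁺(∞,∞,r)`. -/
abbrev BInfPos (r : ℕ) : Type := PresentedMonoid (QRel (r := r) InfGen.t InfGen.s)

/-- The elements `t_i` (`i ∈ ℤ`) of a group that are determined by `t₀`, `t₁` and
`t_i t_{i-1} = t₁ t₀`: for `k = 0, 1`, `t_{2m+k} = (t₁ t₀)^m t_k (t₁ t₀)^{-m}`. -/
def tSeq {G : Type*} [Group G] (t₀ t₁ : G) (i : ℤ) : G :=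
  (t₁ * t₀) ^ (i / 2) * (if i % 2 = 0 then t₀ else t₁) * ((t₁ * t₀) ^ (i / 2))⁻¹

/-- The element `t_i` of `B(∞,∞,r)`. -/
def BInf.t (r : ℕ) (i : ℤ) : BInf r := tSeq (PosGroup.gen _ ShiGen.t₀) (PosGroup.gen _ ShiGen.t₁) i

/-- The element `s_j` of `B(∞,∞,r)`. -/
def BInf.s (r : ℕ) (j : SIdx r) : BInf r := PosGroup.gen _ (ShiGen.s j)

/-- The element `t_i` of `B⁺(∞,∞,r)`. -/
def BInfPos.t (r : ℕ) (i : ℤ) : BInfPos r := PresentedMonoid.of _ (InfGen.t i)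

/-- The element `s_j` of `B⁺(∞,∞,r)`. -/
def BInfPos.s (r : ℕ) (j : SIdx r) : BInfPos r := PresentedMonoid.of _ (InfGen.s j)

/-! ### The group `B(de,e,r)` and the monoid `B⁺(de,e,r)` -/

/-- The generators of the Broué–Malle–Rouquier presentation. -/
inductive BMRGen (r : ℕ) : Type
  | z | t₀ | t₁ | s (j : SIdx r)

open FreeMonoid BMRGen in
/-- The relations of the Broué–Malle–Rouquier presentation of `B(de,e,r)`. -/
inductive BMRRel (e r : ℕ) : PosRel (BMRGen r)
  | common (u v : FreeMonoid (BMRGen r)) (h : PRel (r := r) t₀ t₁ s u v) : BMRRel e r u v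
  | r1 : BMRRel e r (of z * of t₁ * of t₀) (of t₁ * of t₀ * of z)
  | r2 : BMRRel e r (of z * altWord t₁ t₀ e) (of t₀ * of z * altWord t₁ t₀ (e - 1))
  | r3 (j : SIdx r) : BMRRel e r (of z * of (s j)) (of (s j) * of z)

/-- The braid group `B(de,e,r)` (for `d, r ≥ 2` and `e ≥ 1`), through its
Broué–Malle–Rouquier presentation. For `d ≥ 2` the parameter `d` does not enter the relations. -/
abbrev BDeer (_d e r : ℕ) : Type := PosGroup (BMRRel e r)

/-- The generators `z`, `t_i` (`i ∈ ℤ`) and `s₃, …, s_r` of the new presentation. -/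
inductive DeerGen (r : ℕ) : Type
  | z | t (i : ℤ) | s (j : SIdx r)

open FreeMonoid DeerGen in
/-- The relations of the new presentation of `B(de,e,r)`: those of `B⁺(∞,∞,r)`, and
`(Q₄)`, `(Q₅)`. -/
inductive DeerRel (e r : ℕ) : PosRel (DeerGen r)
  | common (u v : FreeMonoid (DeerGen r)) (h : QRel (r := r) t s u v) : DeerRel e r u v
  | q4 (i : ℤ) : DeerRel e r (of z * of (t i)) (of (t (i - e)) * of z)
  | q5 (j : SIdx r) : DeerRel e r (of z * of (s j)) (of (s j) * of z)

/-- The monoid `B⁺(de,e,r)`; its presentation does not involve `d`. -/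
abbrev BDeerPos (e r : ℕ) : Type := PresentedMonoid (DeerRel e r)

/-- The element `z` of `B(de,e,r)`. -/
def BDeer.z (d e r : ℕ) : BDeer d e r := PosGroup.gen _ BMRGen.z

/-- The element `t_i` of `B(de,e,r)`. -/
def BDeer.t (d e r : ℕ) (i : ℤ) : BDeer d e r :=
  tSeq (PosGroup.gen _ BMRGen.t₀) (PosGroup.gen _ BMRGen.t₁) i

/-- The element `s_j` of `B(de,e,r)`. -/
def BDeer.s (d e r : ℕ) (j : SIdx r) : BDeer d e r := PosGroup.gen _ (BMRGen.s j)

/-- The element `z` of `B⁺(de,e,r)`. -/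
def BDeerPos.z (e r : ℕ) : BDeerPos e r := PresentedMonoid.of _ DeerGen.z

/-- The element `t_i` of `B⁺(de,e,r)`. -/
def BDeerPos.t (e r : ℕ) (i : ℤ) : BDeerPos e r := PresentedMonoid.of _ (DeerGen.t i)

/-- The element `s_j` of `B⁺(de,e,r)`. -/
def BDeerPos.s (e r : ℕ) (j : SIdx r) : BDeerPos e r := PresentedMonoid.of _ (DeerGen.s j)

/-- `A = s_r s_{r-1} ⋯ s₃`, as an element of `B⁺(de,e,r)`. -/
def BDeerPos.A (e r : ℕ) : BDeerPos e r :=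
  ((List.finRange (r - 2)).reverse.map fun k : Fin (r - 2) =>
    BDeerPos.s e r ⟨(k : ℕ) + 3, by have := k.isLt; omega⟩).prod

/-- `Λ = (A t₁ t₀)^{r-1}`, as an element of `B⁺(de,e,r)`. -/
def BDeerPos.Lam (e r : ℕ) : BDeerPos e r :=
  (BDeerPos.A e r * BDeerPos.t e r 1 * BDeerPos.t e r 0) ^ (r - 1)

/-! ### Infinite cyclic groups and semidirect products -/

/-- The infinite cyclic group `C_∞`. -/
abbrev CInf : Type := Multiplicative ℤ

/-- The generator `c` of `C_∞`. -/
def CInf.c : CInf := Multiplicative.ofAdd 1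

/-- The subgroup `C_∞^e` of `C_∞` generated by `c^e`. -/
abbrev CInfE (e : ℕ) : Subgroup CInf := Subgroup.zpowers (CInf.c ^ e)

/-- The generator `z = c^e` of `C_∞^e`. -/
def CInfE.z (e : ℕ) : CInfE e := ⟨CInf.c ^ e, Subgroup.mem_zpowers _⟩

/-- The monoid `(C_∞^e)⁺ = {zⁿ | n ≥ 0}`. -/
abbrev CInfEPos (e : ℕ) : Submonoid (CInfE e) := Submonoid.powers (CInfE.z e)

/-- The semidirect product of monoids `G ⋉ N` for an action `φ` of `G` on `N` by automorphisms;
the multiplication agrees with that of the semidirect product of groups `N ⋊[φ] G`. -/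
@[ext]
structure MonoidSemidirect (N G : Type*) [Monoid N] [Monoid G] (φ : G →* MulAut N) where
  left : N
  right : G

namespace MonoidSemidirect

instance {N G : Type*} [Monoid N] [Monoid G] (φ : G →* MulAut N) :
    Monoid (MonoidSemidirect N G φ) where
  mul a b := ⟨a.left * φ a.right b.left, a.right * b.right⟩
  one := ⟨1, 1⟩
  mul_assoc a b c := by
    apply MonoidSemidirect.ext
    · change a.left * φ a.right b.left * φ (a.right * b.right) c.left =
        a.left * φ a.right (b.left * φ b.right c.left)
      simp [mul_assoc]
    · exact mul_assoc a.right b.right c.right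
  one_mul a := by
    apply MonoidSemidirect.ext
    · change 1 * φ 1 a.left = a.left
      simp
    · exact one_mul a.right
  mul_one a := by
    apply MonoidSemidirect.ext
    · change a.left * φ a.right 1 = a.left
      simp
    · exact mul_one a.right

/-- The element of `G ⋉ N` given by an element of `N`. -/
def inl {N G : Type*} [Monoid N] [Monoid G] (φ : G →* MulAut N) (n : N) :
    MonoidSemidirect N G φ := ⟨n, 1⟩

/-- The element of `G ⋉ N` given by an element of `G`. -/
def inr {N G : Type*} [Monoid N] [Monoid G] (φ : G →* MulAut N) (g : G) :
    MonoidSemidirect N G φ := ⟨1, g⟩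

end MonoidSemidirect

/-! The core is the monoid B⁺(∞,∞,r). Its relations preserve word length, and Garside's
word-reversing argument (`PresentedMonoid.eq_control`, `BInfPos.ctl_of_eq`) shows that an equality a
x = b y with letters a, b is a right multiple of the basic relation between a and b. The substance
of that argument is a check on triples of letters, `BInfPos.Ctl.trans`. It yields left cancellation,
and least common right multiples of elements that have some common right multiple.

Common multiples come from Λ. Put τ = t₁t₀. Then τ, s₃, …, s_r satisfy the braid relations of type
B_{r-1}, Λ is the (r-1)-st power of the Coxeter-type product s_r⋯s₃τ, it commutes with every s_j,
and Λ t_i = t_{i+r} Λ. Every generator divides Λ, so any two elements divide a common power of Λ.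

In a group, a sequence with constant product t_i t_{i-1} is determined by t₀ and that constant.
Hence in groups the relations in t₀, t₁ are equivalent to those in all t_i: the length-four relation
propagates the braid relation with s₃ along the sequence (`braid_iff_braid`), and the alternating
relation of length e + 1 says z t_e = t₀ z. This gives the new presentation; the semidirect
decompositions follow by building inverse homomorphisms from universal properties.

In the semidirect product divisibility is componentwise, so left cancellation and lcms pass to
B⁺(de,e,r); greatest common divisors follow by maximal length. An anti-automorphism with t_i ↦
t_{-i} gives the right-hand statements. By Ore's theorem the monoid embeds in some group, and this
embedding factors through B(de,e,r), so the natural map is injective. Finally z^pΛ^q is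
quasi-central and divisible by all generators, which makes it a Garside element. -/

/-! ### Least common multiples and lattices in monoids with a length -/

/-- `m` is a least common right multiple of `a` and `b`. -/
def IsRightLcm {M : Type*} [Monoid M] (a b m : M) : Prop :=
  a ∣ m ∧ b ∣ m ∧ ∀ n, a ∣ n → b ∣ n → m ∣ n

/-- `ℓ` is an additive length on `M` that vanishes only at `1`. -/
structure IsLength {M : Type*} [Monoid M] (ℓ : M → ℕ) : Prop where
  map_mul : ∀ a b, ℓ (a * b) = ℓ a + ℓ b
  eq_one : ∀ a, ℓ a = 0 → a = 1

namespace IsLength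

variable {M : Type*} [Monoid M] {ℓ : M → ℕ} (hℓ : IsLength ℓ)
include hℓ

theorem le_of_dvd {a b : M} (h : a ∣ b) : ℓ a ≤ ℓ b := by
  obtain ⟨c, rfl⟩ := h
  rw [hℓ.map_mul]
  omega

theorem eq_of_dvd {a b : M} (h : a ∣ b) (hle : ℓ b ≤ ℓ a) : a = b := by
  obtain ⟨c, rfl⟩ := h
  rw [hℓ.map_mul] at hle
  rw [hℓ.eq_one c (by omega), mul_one]

theorem dvd_antisymm {a b : M} (h : a ∣ b) (h' : b ∣ a) : a = b :=
  hℓ.eq_of_dvd h (hℓ.le_of_dvd h')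

theorem isAtomicMonoid : IsAtomicMonoid M := by
  have key : ∀ l : List M, (∀ x ∈ l, x ≠ 1) → l.length ≤ ℓ l.prod := by
    intro l
    induction l with
    | nil => simp
    | cons a l ih =>
      intro h
      have h1 := ih fun x hx => h x (List.mem_cons_of_mem _ hx)
      have h2 : ℓ a ≠ 0 := fun h0 => h a List.mem_cons_self (hℓ.eq_one a h0)
      rw [List.prod_cons, hℓ.map_mul, List.length_cons]
      omega
  exact fun m => ⟨ℓ m, fun l hl hm => hm ▸ key l hl⟩

/-- A common divisor g of maximal length works: the lcm of g with another common divisor still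
divides a and b, so by maximality it equals g. -/
theorem exists_gcd (hlcm : ∀ a b : M, ∃ m, IsRightLcm a b m) (a b : M) :
    ∃ g, g ∣ a ∧ g ∣ b ∧ ∀ c, c ∣ a → c ∣ b → c ∣ g := by
  classical
  have hP : ∃ k, ∃ c, c ∣ a ∧ c ∣ b ∧ ℓ a - ℓ c = k := ⟨_, 1, one_dvd _, one_dvd _, rfl⟩
  obtain ⟨g, ha, hb, hg⟩ := Nat.find_spec hP
  refine ⟨g, ha, hb, fun c hca hcb => ?_⟩
  obtain ⟨m, hgm, hcm, hm⟩ := hlcm g c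
  have h1 := Nat.find_min' hP ⟨m, hm a ha hca, hm b hb hcb, rfl⟩
  have h2 := hℓ.le_of_dvd ha
  have h3 := hℓ.le_of_dvd (hm a ha hca)
  rw [hℓ.eq_of_dvd hgm (by omega)]
  exact hcm

theorem exists_lattice (hlcm : ∀ a b : M, ∃ m, IsRightLcm a b m) :
    ∃ L : Lattice M, ∀ a b : M, L.le a b ↔ a ∣ b := by
  choose sup hsup using hlcm
  choose inf hinf using hℓ.exists_gcd fun a b => ⟨sup a b, hsup a b⟩
  exact ⟨{
    le := fun a b => a ∣ b
    le_refl := fun a => dvd_refl a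
    le_trans := fun a b c => dvd_trans
    le_antisymm := fun a b => hℓ.dvd_antisymm
    sup := sup
    inf := inf
    le_sup_left := fun a b => (hsup a b).1
    le_sup_right := fun a b => (hsup a b).2.1
    sup_le := fun a b c ha hb => (hsup a b).2.2 c ha hb
    inf_le_left := fun a b => (hinf a b).1
    inf_le_right := fun a b => (hinf a b).2.1
    le_inf := fun a b c hb hc => (hinf b c).2.2 a hb hc }, fun _ _ => Iff.rfl⟩

end IsLength

theorem dvd_of_mul_dvd_mul_left_of_cancel {M : Type*} [Monoid M]
    (hc : ∀ a b c : M, a * b = a * c → b = c) {a b c : M} (h : a * b ∣ a * c) : b ∣ c := by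
  obtain ⟨d, hd⟩ := h
  exact ⟨d, hc a _ _ (by rw [hd, mul_assoc])⟩

theorem IsRightLcm.mul_left {M : Type*} [Monoid M] (hc : ∀ a b c : M, a * b = a * c → b = c)
    {a b m : M} (h : IsRightLcm a b m) (x : M) : IsRightLcm (x * a) (x * b) (x * m) := by
  refine ⟨mul_dvd_mul_left x h.1, mul_dvd_mul_left x h.2.1, ?_⟩
  rintro _ ⟨u, rfl⟩ hb
  rw [mul_assoc] at hb ⊢
  exact mul_dvd_mul_left x (h.2.2 _ (Dvd.intro _ rfl) (dvd_of_mul_dvd_mul_left_of_cancel hc hb))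

/-- If two letters with a common multiple have a least common multiple, then so do any two
elements. -/
theorem exists_isRightLcm_of_letters {M α : Type*} [Monoid M] {ℓ : M → ℕ} (hℓ : IsLength ℓ)
    (hc : ∀ a b c : M, a * b = a * c → b = c) (g : α → M) (hg : ∀ a, ℓ (g a) = 1)
    (hgen : ∀ x : M, x ≠ 1 → ∃ a y, x = g a * y)
    (hlcm : ∀ a b w, g a ∣ w → g b ∣ w → ∃ m, IsRightLcm (g a) (g b) m) :
    ∀ (n : ℕ) (w x y : M), ℓ w ≤ n → x ∣ w → y ∣ w → ∃ m, IsRightLcm x y m := by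
  intro n
  induction n with
  | zero =>
    intro w x y hw hx hy
    have h1 : x = 1 := hℓ.eq_one _ (by have := hℓ.le_of_dvd hx; omega)
    subst h1
    exact ⟨y, one_dvd _, dvd_refl y, fun _ _ h => h⟩
  | succ n ih =>
    intro w x y hw hx hy
    by_cases hx1 : x = 1
    · subst hx1
      exact ⟨y, one_dvd _, dvd_refl y, fun _ _ h => h⟩
    by_cases hy1 : y = 1
    · subst hy1
      exact ⟨x, dvd_refl x, one_dvd _, fun _ h _ => h⟩
    obtain ⟨a, x', rfl⟩ := hgen x hx1
    obtain ⟨b, y', rfl⟩ := hgen y hy1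
    have ha : g a ∣ w := (Dvd.intro _ rfl).trans hx
    have hb : g b ∣ w := (Dvd.intro _ rfl).trans hy
    obtain ⟨m, ham, hbm, hm⟩ := hlcm a b w ha hb
    -- Both elements start with the letter c; cancelling it shortens the common multiple w.
    have step : ∀ (c : α) (z : M), g c * z ∣ w → g c ∣ m → m ∣ w →
        ∃ k, IsRightLcm (g c * z) m k := by
      intro c z hz hcm hmw
      obtain ⟨p, rfl⟩ := hcm
      obtain ⟨w', rfl⟩ : g c ∣ w := (Dvd.intro _ rfl).trans hz
      rw [hℓ.map_mul, hg] at hw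
      obtain ⟨k, hk⟩ := ih w' z p (by omega) (dvd_of_mul_dvd_mul_left_of_cancel hc hz)
        (dvd_of_mul_dvd_mul_left_of_cancel hc hmw)
      exact ⟨_, hk.mul_left hc (g c)⟩
    have hmw := hm w ha hb
    obtain ⟨k, hk⟩ := step a x' hx ham hmw
    obtain ⟨k', hk'⟩ := step b y' hy hbm hmw
    obtain ⟨u, rfl⟩ := hk.2.1
    obtain ⟨u', rfl⟩ := hk'.2.1
    have hu := hk.2.2 w hx hmw
    have hu' := hk'.2.2 w hy hmw
    obtain ⟨w', rfl⟩ := hmw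
    have hlen : 1 ≤ ℓ m := hg a ▸ hℓ.le_of_dvd ham
    rw [hℓ.map_mul] at hw
    -- The two lcms are multiples of m, which contains a letter; cancelling m again shortens the
    -- bound.
    obtain ⟨v, hv⟩ := ih w' u u' (by omega) (dvd_of_mul_dvd_mul_left_of_cancel hc hu)
      (dvd_of_mul_dvd_mul_left_of_cancel hc hu')
    have hv' := hv.mul_left hc m
    refine ⟨m * v, hk.1.trans hv'.1, hk'.1.trans hv'.2.1, fun n hxn hyn => ?_⟩
    have hmn := hm n ((Dvd.intro _ rfl).trans hxn) ((Dvd.intro _ rfl).trans hyn)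
    exact hv'.2.2 n (hk.2.2 n hxn hmn) (hk'.2.2 n hyn hmn)

/-! ### Word reversing in homogeneous presented monoids -/

namespace PresentedMonoid

variable {α : Type} {R : PosRel α}

/-- The word length on a homogeneous presented monoid. -/
def wordLength (hR : ∀ u v, R u v → u.length = v.length) (x : PresentedMonoid R) : ℕ :=
  Multiplicative.toAdd (PresentedMonoid.lift (fun _ : α => Multiplicative.ofAdd 1) (fun u v h => by
    have key : ∀ w : FreeMonoid α,
        FreeMonoid.lift (fun _ : α => Multiplicative.ofAdd (1 : ℕ)) w =
          Multiplicative.ofAdd w.length := by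
      intro w
      induction w using FreeMonoid.inductionOn' with
      | one => rfl
      | of_mul x xs ih =>
        rw [map_mul, ih, FreeMonoid.lift_eval_of, FreeMonoid.length_mul, FreeMonoid.length_of,
          ofAdd_add]
    rw [key, key, hR u v h]) x)

theorem wordLength_of (hR : ∀ u v, R u v → u.length = v.length) (a : α) :
    wordLength hR (of R a) = 1 := rfl

theorem wordLength_mul (hR : ∀ u v, R u v → u.length = v.length) (x y : PresentedMonoid R) :
    wordLength hR (x * y) = wordLength hR x + wordLength hR y := by
  simp [wordLength]

theorem wordLength_mk (hR : ∀ u v, R u v → u.length = v.length) (w : FreeMonoid α) :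
    wordLength hR (mk R w) = w.length := by
  induction w using FreeMonoid.inductionOn' with
  | one => simp [wordLength]
  | of_mul x xs ih =>
    rw [map_mul, wordLength_mul, ih, FreeMonoid.length_mul, FreeMonoid.length_of]
    rfl

theorem exists_eq_of_mul {x : PresentedMonoid R} (hx : x ≠ 1) : ∃ a y, x = of R a * y := by
  induction x with | _ w
  induction w using FreeMonoid.inductionOn' with
  | one => exact absurd (map_one _) hx
  | of_mul a w _ => exact ⟨a, mk R w, by rw [map_mul]; rfl⟩

theorem isLength_wordLength (hR : ∀ u v, R u v → u.length = v.length) :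
    IsLength (wordLength hR) where
  map_mul := wordLength_mul hR
  eq_one x hx := by
    by_contra h
    obtain ⟨a, y, rfl⟩ := exists_eq_of_mul h
    rw [wordLength_mul, wordLength_of] at hx
    omega

/-- Garside's lemma: in a homogeneous presented monoid, `T` controls all equalities
`a x = b y` with letters `a`, `b`, if it does so for the relations and if it is transitive as soon
as it controls all shorter equalities. -/
theorem eq_control (hR : ∀ u v, R u v → u.length = v.length)
    (T : α → PresentedMonoid R → α → PresentedMonoid R → Prop)
    (hrel : ∀ u v, R u v → ∃ a x b y, u = .of a * x ∧ v = .of b * y ∧ T a (mk R x) b (mk R y))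
    (hrefl : ∀ a x, T a x a x) (hsymm : ∀ a x b y, T a x b y → T b y a x)
    (hmul : ∀ a x b y z, T a x b y → T a (x * z) b (y * z))
    (htrans : ∀ n, (∀ a x b y, wordLength hR x < n → of R a * x = of R b * y → T a x b y) →
      ∀ a x c z b y, wordLength hR x ≤ n → T a x c z → T c z b y → T a x b y) :
    ∀ a x b y, of R a * x = of R b * y → T a x b y := by
  have len_eq : ∀ u v, ConGen.Rel R u v → u.length = v.length := fun u v h => by
    have := congrArg (wordLength hR) (mk_eq_mk_iff.2 h : mk R u = mk R v)
    rwa [wordLength_mk, wordLength_mk] at this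
  -- Words, unlike elements, have a well-defined first letter, so the induction runs over
  -- derivations of congruences between words.
  let P : FreeMonoid α → FreeMonoid α → Prop := fun u v =>
    (u = 1 ∧ v = 1) ∨ ∃ a x b y, u = .of a * x ∧ v = .of b * y ∧ T a (mk R x) b (mk R y)
  have P_of : ∀ a x b y, P (.of a * x) (.of b * y) → T a (mk R x) b (mk R y) := by
    rintro a x b y (⟨h, _⟩ | ⟨a', x', b', y', h1, h2, h3⟩)
    · exact absurd (congrArg FreeMonoid.length h) (by
        rw [FreeMonoid.length_mul, FreeMonoid.length_of, FreeMonoid.length_one]; omega)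
    · obtain ⟨rfl, rfl⟩ := List.cons.inj (congrArg FreeMonoid.toList h1)
      obtain ⟨rfl, rfl⟩ := List.cons.inj (congrArg FreeMonoid.toList h2)
      exact h3
  have main : ∀ n, ∀ u v, ConGen.Rel R u v → u.length ≤ n → P u v := by
    intro n
    induction n with
    | zero =>
      intro u v h hu
      have hv := len_eq u v h
      exact Or.inl ⟨FreeMonoid.length_eq_zero.1 (by omega), FreeMonoid.length_eq_zero.1 (by omega)⟩
    | succ n ihn =>
      -- A tail of length below n gives a word of length at most n, to which the outer induction
      -- applies, whatever derivation is used.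
      have hK : ∀ a x b y, wordLength hR x < n → of R a * x = of R b * y → T a x b y := by
        intro a x b y hx hxy
        induction x with | _ x
        induction y with | _ y
        rw [wordLength_mk] at hx
        refine P_of a x b y (ihn _ _ (mk_eq_mk_iff (x := .of a * x) (y := .of b * y) |>.1 hxy) ?_)
        rw [FreeMonoid.length_mul, FreeMonoid.length_of]
        omega
      intro u v h
      induction h with
      | of u v h => exact fun _ => Or.inr (hrel u v h)
      | refl u =>
        intro _
        induction u using FreeMonoid.inductionOn' with
        | one => exact Or.inl ⟨rfl, rfl⟩
        | of_mul a x _ => exact Or.inr ⟨a, x, a, x, rfl, rfl, hrefl _ _⟩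
      | symm h ih =>
        intro hu
        rcases ih (by rw [len_eq _ _ h]; exact hu) with ⟨h1, h2⟩ | ⟨a, x, b, y, h1, h2, h3⟩
        · exact Or.inl ⟨h2, h1⟩
        · exact Or.inr ⟨b, y, a, x, h2, h1, hsymm _ _ _ _ h3⟩
      | @trans u v w h h' ih ih' =>
        intro hu
        have hv := len_eq _ _ h
        rcases ih hu with ⟨h1, h2⟩ | ⟨a, x, b, y, h1, h2, h3⟩
        · have hw := len_eq _ _ h'
          rw [h2, FreeMonoid.length_one] at hw
          exact Or.inl ⟨h1, FreeMonoid.length_eq_zero.1 hw.symm⟩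
        · rcases ih' (by omega) with ⟨h1', h2'⟩ | ⟨b', y', c, z, h1', h2', h3'⟩
          · rw [h2] at h1'
            exact absurd (congrArg FreeMonoid.length h1') (by
              rw [FreeMonoid.length_mul, FreeMonoid.length_of, FreeMonoid.length_one]; omega)
          · rw [h2] at h1'
            obtain ⟨rfl, rfl⟩ := List.cons.inj (congrArg FreeMonoid.toList h1')
            refine Or.inr ⟨a, x, c, z, h1, h2', htrans n hK _ _ _ _ _ _ ?_ h3 h3'⟩
            rw [h1, FreeMonoid.length_mul, FreeMonoid.length_of] at hu
            rw [wordLength_mk]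
            omega
      | @mul w x y z h h' ih ih' =>
        intro hu
        rw [FreeMonoid.length_mul] at hu
        rcases ih (by omega) with ⟨rfl, rfl⟩ | ⟨a, w', b, x', rfl, rfl, h3⟩
        · rw [one_mul, one_mul]
          exact ih' (by omega)
        · refine Or.inr ⟨a, w' * y, b, x' * z, mul_assoc _ _ _, mul_assoc _ _ _, ?_⟩
          have hyz : mk R y = mk R z := mk_eq_mk_iff.2 h'
          rw [map_mul, map_mul, hyz]
          exact hmul _ _ _ _ _ h3
  intro a x b y hxy
  induction x with | _ x
  induction y with | _ y
  exact P_of a x b y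
    (main _ _ _ (mk_eq_mk_iff (x := .of a * x) (y := .of b * y) |>.1 hxy) le_rfl)

end PresentedMonoid

/-! ### Systems of elements that satisfy the relations -/

/-- The elements `t i` and `s j` satisfy the relations of `B⁺(∞,∞,r)`. -/
structure IsQSystem {N : Type*} [Monoid N] {r : ℕ} (t : ℤ → N) (s : SIdx r → N) : Prop where
  comm : ∀ j k : SIdx r, (j : ℕ) + 1 < k → s j * s k = s k * s j
  braid : ∀ j k : SIdx r, (k : ℕ) = j + 1 → s j * s k * s j = s k * s j * s k
  q1 : ∀ i j, t i * t (i - 1) = t j * t (j - 1)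
  q2 : ∀ j : SIdx r, (j : ℕ) = 3 → ∀ i, s j * t i * s j = t i * s j * t i
  q3 : ∀ j : SIdx r, 4 ≤ (j : ℕ) → ∀ i, s j * t i = t i * s j

/-- The elements `z`, `t i` and `s j` satisfy the relations of `B⁺(de,e,r)`. -/
structure IsDSystem {N : Type*} [Monoid N] (e : ℕ) {r : ℕ} (z : N) (t : ℤ → N) (s : SIdx r → N) :
    Prop extends IsQSystem t s where
  q4 : ∀ i, z * t i = t (i - e) * z
  q5 : ∀ j, z * s j = s j * z

/-- The elements `t₀`, `t₁` and `s j` satisfy the relations of Shi's presentation. -/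
structure IsPSystem {N : Type*} [Monoid N] {r : ℕ} (t₀ t₁ : N) (s : SIdx r → N) : Prop where
  comm : ∀ j k : SIdx r, (j : ℕ) + 1 < k → s j * s k = s k * s j
  braid : ∀ j k : SIdx r, (k : ℕ) = j + 1 → s j * s k * s j = s k * s j * s k
  p2_zero : ∀ j : SIdx r, (j : ℕ) = 3 → s j * t₀ * s j = t₀ * s j * t₀
  p2_one : ∀ j : SIdx r, (j : ℕ) = 3 → s j * t₁ * s j = t₁ * s j * t₁
  p3_zero : ∀ j : SIdx r, 4 ≤ (j : ℕ) → s j * t₀ = t₀ * s j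
  p3_one : ∀ j : SIdx r, 4 ≤ (j : ℕ) → s j * t₁ = t₁ * s j
  p4 : ∀ j : SIdx r, (j : ℕ) = 3 →
    s j * (t₁ * t₀) * s j * (t₁ * t₀) = (t₁ * t₀) * s j * (t₁ * t₀) * s j

/-- The elements `z`, `t₀`, `t₁` and `s j` satisfy the Broué–Malle–Rouquier relations. -/
structure IsBMRSystem {N : Type*} [Monoid N] (e : ℕ) {r : ℕ} (z t₀ t₁ : N) (s : SIdx r → N) :
    Prop extends IsPSystem t₀ t₁ s where
  r1 : z * t₁ * t₀ = t₁ * t₀ * z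
  r2 : z * FreeMonoid.lift (fun b : Bool => cond b t₁ t₀) (altWord true false e) =
    t₀ * z * FreeMonoid.lift (fun b : Bool => cond b t₁ t₀) (altWord true false (e - 1))
  r3 : ∀ j, z * s j = s j * z

/-! ### Compatibility with a presentation as a system of equations -/

section Lift

variable {N : Type*} [Monoid N] {α : Type} {r : ℕ} (f : α → N)

/-- Applied to the tautological letters, the forward direction extracts the relations as equations;
the backward direction supplies the hypothesis of a lift. -/
theorem qRel_lift_iff (t : ℤ → α) (s : SIdx r → α) :
    (∀ u v, QRel t s u v → FreeMonoid.lift f u = FreeMonoid.lift f v) ↔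
      IsQSystem (fun i => f (t i)) (fun j => f (s j)) := by
  constructor
  · intro h
    refine ⟨fun j k hjk => ?_, fun j k hjk => ?_, fun i j => ?_, fun j hj i => ?_, fun j hj i => ?_⟩
    · simpa using h _ _ (.braid _ _ (.comm j k hjk))
    · simpa using h _ _ (.braid _ _ (.braid j k hjk))
    · simpa using h _ _ (.q1 i j)
    · simpa using h _ _ (.q2 j hj i)
    · simpa using h _ _ (.q3 j hj i)
  · rintro h u v (⟨_, _, ⟨j, k, hjk⟩ | ⟨j, k, hjk⟩⟩ | ⟨i, j⟩ | ⟨j, hj, i⟩ | ⟨j, hj, i⟩)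
    · simpa using h.comm j k hjk
    · simpa using h.braid j k hjk
    · simpa using h.q1 i j
    · simpa using h.q2 j hj i
    · simpa using h.q3 j hj i

theorem pRel_lift_iff (t₀ t₁ : α) (s : SIdx r → α) :
    (∀ u v, PRel t₀ t₁ s u v → FreeMonoid.lift f u = FreeMonoid.lift f v) ↔
      IsPSystem (f t₀) (f t₁) (fun j => f (s j)) := by
  constructor
  · intro h
    refine ⟨fun j k hjk => ?_, fun j k hjk => ?_, fun j hj => ?_, fun j hj => ?_, fun j hj => ?_,
      fun j hj => ?_, fun j hj => ?_⟩
    · simpa using h _ _ (.braid _ _ (.comm j k hjk))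
    · simpa using h _ _ (.braid _ _ (.braid j k hjk))
    · simpa using h _ _ (.p2_zero j hj)
    · simpa using h _ _ (.p2_one j hj)
    · simpa using h _ _ (.p3_zero j hj)
    · simpa using h _ _ (.p3_one j hj)
    · simpa using h _ _ (.p4 j hj)
  · rintro h u v (⟨_, _, ⟨j, k, hjk⟩ | ⟨j, k, hjk⟩⟩ | ⟨j, hj⟩ | ⟨j, hj⟩ | ⟨j, hj⟩ | ⟨j, hj⟩ | ⟨j, hj⟩)
    · simpa using h.comm j k hjk
    · simpa using h.braid j k hjk
    · simpa using h.p2_zero j hj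
    · simpa using h.p2_one j hj
    · simpa using h.p3_zero j hj
    · simpa using h.p3_one j hj
    · simpa using h.p4 j hj

theorem deerRel_lift_iff (e : ℕ) (f : DeerGen r → N) :
    (∀ u v, DeerRel e r u v → FreeMonoid.lift f u = FreeMonoid.lift f v) ↔
      IsDSystem e (f .z) (fun i => f (.t i)) (fun j => f (.s j)) := by
  constructor
  · intro h
    refine ⟨(qRel_lift_iff f .t .s).1 fun u v huv => h u v (.common u v huv), fun i => ?_,
      fun j => ?_⟩
    · simpa using h _ _ (.q4 i)
    · simpa using h _ _ (.q5 j)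
  · rintro h u v (⟨_, _, huv⟩ | i | j)
    · exact (qRel_lift_iff f .t .s).2 h.toIsQSystem u v huv
    · simpa using h.q4 i
    · simpa using h.q5 j

theorem lift_altWord (a b : α) (k : ℕ) :
    FreeMonoid.lift f (altWord a b k) =
      FreeMonoid.lift (fun c : Bool => cond c (f a) (f b)) (altWord true false k) := by
  have key : ∀ k, FreeMonoid.lift f (altWord a b k) =
      FreeMonoid.lift (fun c : Bool => cond c (f a) (f b)) (altWord true false k) ∧
      FreeMonoid.lift f (altWord b a k) =
      FreeMonoid.lift (fun c : Bool => cond c (f a) (f b)) (altWord false true k) := by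
    intro k
    induction k with
    | zero => exact ⟨rfl, rfl⟩
    | succ k ih => simp [altWord, ih.1, ih.2]
  exact (key k).1

theorem bmrRel_lift_iff (e : ℕ) (f : BMRGen r → N) :
    (∀ u v, BMRRel e r u v → FreeMonoid.lift f u = FreeMonoid.lift f v) ↔
      IsBMRSystem e (f .z) (f .t₀) (f .t₁) (fun j => f (.s j)) := by
  constructor
  · intro h
    refine ⟨(pRel_lift_iff f .t₀ .t₁ .s).1 fun u v huv => h u v (.common u v huv), ?_, ?_,
      fun j => ?_⟩
    · simpa using h _ _ .r1
    · simpa [lift_altWord] using h _ _ .r2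
    · simpa using h _ _ (.r3 j)
  · rintro h u v (⟨_, _, huv⟩ | _ | _ | j)
    · exact (pRel_lift_iff f .t₀ .t₁ .s).2 h.toIsPSystem u v huv
    · simpa using h.r1
    · simpa [lift_altWord] using h.r2
    · simpa using h.r3 j

end Lift

namespace PresentedMonoid

theorem lift_of_eq_mk {α : Type} (R : PosRel α) (w : FreeMonoid α) :
    FreeMonoid.lift (of R) w = mk R w :=
  DFunLike.congr_fun (FreeMonoid.hom_eq fun _ => rfl : FreeMonoid.lift (of R) = mk R) w

theorem lift_of_eq_of_rel {α : Type} (R : PosRel α) (u v : FreeMonoid α) (h : R u v) :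
    FreeMonoid.lift (of R) u = FreeMonoid.lift (of R) v := by
  rw [lift_of_eq_mk, lift_of_eq_mk]
  exact mk_eq_mk_of_rel h

end PresentedMonoid

namespace PosGroup

variable {α : Type} {R : PosRel α}

theorem lift_gen_eq_of_rel (u v : FreeMonoid α) (h : R u v) :
    FreeMonoid.lift (gen R) u = FreeMonoid.lift (gen R) v := by
  have key : FreeMonoid.lift (gen R) =
      (PresentedGroup.mk _ : FreeGroup α →* PosGroup R).comp (FreeMonoid.lift FreeGroup.of) :=
    FreeMonoid.hom_eq fun _ => rfl
  rw [key]
  exact PresentedGroup.mk_eq_mk_of_mul_inv_mem ⟨u, v, h, rfl⟩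

/-- The homomorphism from a positively presented group given by elements that satisfy the
relations. -/
def lift {G : Type*} [Group G] (f : α → G)
    (h : ∀ u v, R u v → FreeMonoid.lift f u = FreeMonoid.lift f v) : PosGroup R →* G :=
  PresentedGroup.toGroup (f := f) (by
    rintro _ ⟨u, v, huv, rfl⟩
    have key : ∀ w, FreeGroup.lift f (FreeMonoid.lift FreeGroup.of w) = FreeMonoid.lift f w :=
      DFunLike.congr_fun (FreeMonoid.hom_eq fun _ => by simp :
        (FreeGroup.lift f).comp (FreeMonoid.lift FreeGroup.of) = FreeMonoid.lift f)
    rw [map_mul, map_inv, key, key, h u v huv, mul_inv_cancel])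

@[simp]
theorem lift_gen {G : Type*} [Group G] (f : α → G)
    (h : ∀ u v, R u v → FreeMonoid.lift f u = FreeMonoid.lift f v) (a : α) :
    lift f h (gen R a) = f a := PresentedGroup.toGroup.of _

end PosGroup

theorem isQSystem_bInfPos (r : ℕ) : IsQSystem (BInfPos.t r) (BInfPos.s r) :=
  (qRel_lift_iff _ _ _).1 (PresentedMonoid.lift_of_eq_of_rel _)

theorem isDSystem_bDeerPos (e r : ℕ) :
    IsDSystem e (BDeerPos.z e r) (BDeerPos.t e r) (BDeerPos.s e r) :=
  (deerRel_lift_iff e _).1 (PresentedMonoid.lift_of_eq_of_rel _)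

/-! ### Cancellation and least common multiples in `B⁺(∞,∞,r)` -/

namespace BInfPos

variable {r : ℕ}

/-- The letters `t_i` have level `2`, and `s_j` has level `j`. -/
def level : InfGen r → ℕ
  | .t _ => 2
  | .s j => j

/-- Letters that commute. -/
def Far (a b : InfGen r) : Prop := level a + 1 < level b ∨ level b + 1 < level a

/-- Letters that satisfy a braid relation of length three. -/
def Near (a b : InfGen r) : Prop := level a = level b + 1 ∨ level b = level a + 1

theorem Far.symm {a b : InfGen r} (h : Far a b) : Far b a := Or.symm h

theorem Near.symm {a b : InfGen r} (h : Near a b) : Near b a := Or.symm h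

theorem not_far_self (a : InfGen r) : ¬ Far a a := by unfold Far; omega

theorem not_near_self (a : InfGen r) : ¬ Near a a := by unfold Near; omega

theorem not_far_of_near {a b : InfGen r} (h : Near a b) : ¬ Far a b := by
  unfold Far Near at *; omega

/-- Each s_j has its own level, at least 3, so distinct letters of equal level are both among the
t_i. -/
theorem letters_cases (a b : InfGen r) :
    a = b ∨ (∃ i j, i ≠ j ∧ a = .t i ∧ b = .t j) ∨ Far a b ∨ Near a b := by
  rcases a with i | ⟨j, hj⟩ <;> rcases b with i' | ⟨j', hj'⟩
  · by_cases h : i = i'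
    · exact Or.inl (by rw [h])
    · exact Or.inr (Or.inl ⟨i, i', h, rfl, rfl⟩)
  · simp only [Far, Near, level]
    omega
  · simp only [Far, Near, level]
    omega
  · by_cases h : j = j'
    · subst h
      exact Or.inl rfl
    · simp only [Far, Near, level]
      omega

/-- The image of a letter in `B⁺(∞,∞,r)`. -/
abbrev g (a : InfGen r) : BInfPos r := PresentedMonoid.of _ a

theorem far_comm {a b : InfGen r} (h : Far a b) (x : BInfPos r) :
    g a * (g b * x) = g b * (g a * x) := by
  have hQ := isQSystem_bInfPos r
  have key : ∀ a b : InfGen r, level a + 1 < level b → g a * g b = g b * g a := by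
    rintro (i | j) (i' | j') h <;> simp only [level] at h
    · omega
    · exact (hQ.q3 j' (by omega) i).symm
    · have := j.2.1
      omega
    · exact hQ.comm j j' h
  rw [← mul_assoc, ← mul_assoc]
  rcases h with h | h
  · rw [key a b h]
  · rw [key b a h]

theorem near_braid {a b : InfGen r} (h : Near a b) (x : BInfPos r) :
    g a * (g b * (g a * x)) = g b * (g a * (g b * x)) := by
  have hQ := isQSystem_bInfPos r
  have key : ∀ a b : InfGen r, level b = level a + 1 → g a * g b * g a = g b * g a * g b := by
    rintro (i | j) (i' | j') h <;> simp only [level] at h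
    · omega
    · exact (hQ.q2 j' (by omega) i).symm
    · have := j.2.1
      omega
    · exact hQ.braid j j' h
  simp only [← mul_assoc]
  rcases h with h | h
  · rw [key b a h]
  · rw [key a b h]

theorem t_mul_t (i j : ℤ) (x : BInfPos r) :
    g (.t i) * (g (.t (i - 1)) * x) = g (.t j) * (g (.t (j - 1)) * x) := by
  rw [← mul_assoc, ← mul_assoc]
  exact congrArg (· * x) ((isQSystem_bInfPos r).q1 i j)

/-- With τ = t_i t_{i-1}, this is c τ c t_{i-2} = t_{i-1} c τ c: rewriting τ as t_{i-1} t_{i-2}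
exposes two braid relations. -/
theorem t_shift_near {i : ℤ} {c : InfGen r} (hc : Near (.t i) c) (x : BInfPos r) :
    g c * (g (.t i) * (g (.t (i - 1)) * (g c * (g (.t (i - 1 - 1)) * x)))) =
      g (.t (i - 1)) * (g c * (g (.t i) * (g (.t (i - 1)) * (g c * x)))) := by
  have h1 := near_braid (a := .t (i - 1)) (b := c) hc
  have h2 := near_braid (a := .t (i - 1 - 1)) (b := c) hc
  have h3 := t_mul_t (r := r) i (i - 1)
  rw [h3, h2, ← h1, ← h3]

theorem qRel_length (u v : FreeMonoid (InfGen r)) (h : QRel InfGen.t InfGen.s u v) :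
    u.length = v.length := by
  rcases h with (⟨_, _, ⟨j, k, hjk⟩ | ⟨j, k, hjk⟩⟩ | ⟨i, j⟩ | ⟨j, hj, i⟩ | ⟨j, hj, i⟩) <;> rfl

/-- The length of elements of `B⁺(∞,∞,r)`. -/
def len (x : BInfPos r) : ℕ := PresentedMonoid.wordLength qRel_length x

theorem isLength_len : IsLength (len (r := r)) := PresentedMonoid.isLength_wordLength qRel_length

theorem len_g_mul (a : InfGen r) (x : BInfPos r) : len (g a * x) = len x + 1 := by
  rw [isLength_len.map_mul, add_comm]
  rfl

/-- `Ctl a x b y` says that `a x = b y` is a right multiple of the basic relation between the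
letters `a` and `b`. -/
inductive Ctl : InfGen r → BInfPos r → InfGen r → BInfPos r → Prop
  | refl (a : InfGen r) (x : BInfPos r) : Ctl a x a x
  | tt (i j : ℤ) (x : BInfPos r) :
      Ctl (.t i) (g (.t (i - 1)) * x) (.t j) (g (.t (j - 1)) * x)
  | far (a b : InfGen r) (h : Far a b) (x : BInfPos r) : Ctl a (g b * x) b (g a * x)
  | near (a b : InfGen r) (h : Near a b) (x : BInfPos r) :
      Ctl a (g b * (g a * x)) b (g a * (g b * x))

namespace Ctl

theorem symm {a b : InfGen r} {x y : BInfPos r} (h : Ctl a x b y) : Ctl b y a x := by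
  cases h with
  | refl => exact .refl _ _
  | tt => exact .tt _ _ _
  | far _ _ h => exact .far _ _ h.symm _
  | near _ _ h => exact .near _ _ h.symm _

theorem mul_right {a b : InfGen r} {x y : BInfPos r} (h : Ctl a x b y) (z : BInfPos r) :
    Ctl a (x * z) b (y * z) := by
  cases h with
  | refl => exact .refl _ _
  | tt => simp only [mul_assoc]; exact .tt _ _ _
  | far _ _ h => simp only [mul_assoc]; exact .far _ _ h _
  | near _ _ h => simp only [mul_assoc]; exact .near _ _ h _

theorem len_eq {a b : InfGen r} {x y : BInfPos r} (h : Ctl a x b y) : len x = len y := by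
  cases h <;> simp only [len_g_mul]

theorem eq_of_self {a : InfGen r} {x y : BInfPos r} (h : Ctl a x a y) : x = y := by
  cases h with
  | refl => rfl
  | tt => rfl
  | far _ _ h => exact absurd h (not_far_self _)
  | near _ _ h => exact absurd h (not_near_self _)

theorem exists_of_t {i j : ℤ} (hij : i ≠ j) {x y : BInfPos r} (h : Ctl (.t i) x (.t j) y) :
    ∃ z, x = g (.t (i - 1)) * z ∧ y = g (.t (j - 1)) * z := by
  cases h with
  | refl => exact absurd rfl hij
  | tt _ _ z => exact ⟨z, rfl, rfl⟩
  | far _ _ h => simp only [Far, level] at h; omega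
  | near _ _ h => simp only [Near, level] at h; omega

theorem exists_of_far {a b : InfGen r} (hab : Far a b) {x y : BInfPos r} (h : Ctl a x b y) :
    ∃ z, x = g b * z ∧ y = g a * z := by
  cases h with
  | refl => exact absurd hab (not_far_self _)
  | tt => simp only [Far, level] at hab; omega
  | far _ _ h z => exact ⟨z, rfl, rfl⟩
  | near _ _ h => exact absurd hab (not_far_of_near h)

theorem exists_of_near {a b : InfGen r} (hab : Near a b) {x y : BInfPos r} (h : Ctl a x b y) :
    ∃ z, x = g b * (g a * z) ∧ y = g a * (g b * z) := by
  cases h with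
  | refl => exact absurd hab (not_near_self _)
  | tt => simp only [Near, level] at hab; omega
  | far _ _ h => exact absurd h (not_far_of_near hab)
  | near _ _ h z => exact ⟨z, rfl, rfl⟩

/-! ### Transitivity of the control relation, by triples of letters -/

section Transitivity

variable {n : ℕ}
  (hK : ∀ (a : InfGen r) x b y, len x < n → g a * x = g b * y → Ctl a x b y)
include hK

/-- As c commutes with a and b, it passes through whichever basic relation controls a x = b y. -/
theorem trans_far_far {a b c : InfGen r} {x y : BInfPos r} (hac : Far a c) (hcb : Far c b)
    (hn : len x < n) (h : g a * x = g b * y) : Ctl a (g c * x) b (g c * y) := by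
  have h1 := hK a x b y hn h
  cases h1 with
  | refl => exact .refl _ _
  | tt i j z =>
    rw [far_comm (a := c) (b := .t (i - 1)) hac.symm, far_comm (a := c) (b := .t (j - 1)) hcb]
    exact .tt _ _ _
  | far _ _ h' z =>
    rw [far_comm hcb, far_comm hac.symm]
    exact .far _ _ h' _
  | near _ _ h' z =>
    rw [far_comm hcb, far_comm hac.symm, far_comm hac.symm, far_comm hcb]
    exact .near _ _ h' _

/-- Only two configurations survive: b commutes with a and c, or c, a, b is a chain of type A₃ with
a in the middle. Each shorter equality is solved by control, which makes x and y explicit. -/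
theorem trans_near_far {a b c : InfGen r} {x y : BInfPos r} (hac : Near a c) (hcb : Far c b)
    (hn : len x + 1 < n) (h : g a * (g c * x) = g b * y) : Ctl a (g c * (g a * x)) b (g c * y) := by
  rcases letters_cases a b with rfl | ⟨i, j, hij, rfl, rfl⟩ | hab | hab
  · exact absurd hcb (not_far_of_near hac.symm)
  · exact absurd hcb (not_far_of_near hac.symm)
  · obtain ⟨v, h1, rfl⟩ := (hK _ _ _ _ (by simpa only [len_g_mul]) h).exists_of_far hab
    obtain ⟨w, rfl, rfl⟩ := (hK _ _ _ _ (by omega) h1).exists_of_far hcb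
    rw [far_comm hab, far_comm hcb, near_braid hac.symm]
    exact .far _ _ hab _
  · obtain ⟨v, h1, rfl⟩ := (hK _ _ _ _ (by simpa only [len_g_mul]) h).exists_of_near hab
    obtain ⟨p, rfl, h2⟩ := (hK _ _ _ _ (by omega) h1).exists_of_far hcb
    have hl := congrArg len h1
    simp only [len_g_mul] at hl hn
    obtain ⟨q, rfl, rfl⟩ := (hK _ _ _ _ (by omega) h2).exists_of_near hac
    have e1 : g c * (g a * (g b * (g a * (g c * q)))) =
        g b * (g a * (g c * (g a * (g b * q)))) := by
      have h1 := near_braid hac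
      have h2 := near_braid hab
      have h3 := far_comm hcb
      grind
    have e2 : g c * (g a * (g b * (g c * (g a * q)))) =
        g a * (g b * (g c * (g a * (g b * q)))) := by
      have h1 := near_braid hac
      have h2 := near_braid hab
      have h3 := far_comm hcb
      grind
    rw [e1, e2]
    exact .near _ _ hab _

/-- The letters a and b both have levels adjacent to that of c. Thus they are equal, two different
t's, or the ends of an A₃ chain; parity of the level excludes that they are adjacent. -/
theorem trans_near_near {a b c : InfGen r} {x y : BInfPos r} (hac : Near a c) (hcb : Near c b)
    (hn : len x + 1 < n) (h : g a * (g c * x) = g b * (g c * y)) :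
    Ctl a (g c * (g a * x)) b (g c * (g b * y)) := by
  have hl := congrArg len h
  simp only [len_g_mul] at hl
  rcases letters_cases a b with rfl | ⟨i, j, hij, rfl, rfl⟩ | hab | hab
  · have h1 := (hK _ _ _ _ (by rw [len_g_mul]; omega) h).eq_of_self
    rw [(hK _ _ _ _ (by omega) h1).eq_of_self]
    exact .refl _ _
  · obtain ⟨v, h1, h2⟩ := (hK _ _ _ _ (by rw [len_g_mul]; omega) h).exists_of_t hij
    have hl1 := congrArg len h1
    simp only [len_g_mul] at hl1
    obtain ⟨p, rfl, rfl⟩ := (hK _ _ _ _ (by omega) h1).exists_of_near (b := .t (i - 1)) hac.symm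
    obtain ⟨q, rfl, h3⟩ := (hK _ _ _ _ (by omega) h2).exists_of_near (b := .t (j - 1)) hcb
    simp only [len_g_mul] at hl1 hn hl
    have h4 := (hK _ _ _ _ (by rw [len_g_mul]; omega) h3).eq_of_self
    obtain ⟨w, rfl, rfl⟩ := (hK _ _ _ _ (by omega) h4).exists_of_t (by omega)
    -- Here x and y have been solved in terms of w; the shift identity brings t_{i-1}, resp.
    -- t_{j-1}, to the front, with remainder c τ c w on both sides.
    rw [t_shift_near hac, t_shift_near (i := j) hcb.symm, t_mul_t j i]
    exact .tt _ _ _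
  · obtain ⟨v, h1, h2⟩ := (hK _ _ _ _ (by rw [len_g_mul]; omega) h).exists_of_far hab
    have hl1 := congrArg len h1
    simp only [len_g_mul] at hl1
    obtain ⟨p, rfl, rfl⟩ := (hK _ _ _ _ (by omega) h1).exists_of_near hcb
    obtain ⟨q, rfl, h3⟩ := (hK _ _ _ _ (by omega) h2).exists_of_near hac.symm
    simp only [len_g_mul] at hl1 hn hl
    have h4 := (hK _ _ _ _ (by rw [len_g_mul]; omega) h3).eq_of_self
    obtain ⟨w, rfl, rfl⟩ := (hK _ _ _ _ (by omega) h4).exists_of_far hab.symm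
    have h1 := near_braid hac
    have h2 := near_braid hcb
    have h3 := far_comm hab
    have e1 : g c * (g a * (g b * (g c * (g a * w)))) =
        g b * (g c * (g b * (g a * (g c * w)))) := by grind
    have e2 : g c * (g b * (g a * (g c * (g b * w)))) =
        g a * (g c * (g b * (g a * (g c * w)))) := by grind
    rw [e1, e2]
    exact .far _ _ hab _
  · unfold Near at *
    omega

theorem trans_t_far {i j : ℤ} {b : InfGen r} {x y : BInfPos r} (hjb : Far (.t j) b)
    (hn : len x < n) (h : g (.t (j - 1)) * x = g b * y) :
    Ctl (.t i) (g (.t (i - 1)) * x) b (g (.t j) * y) := by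
  obtain ⟨w, rfl, rfl⟩ := (hK _ _ _ _ (by omega) h).exists_of_far (a := .t (j - 1)) hjb
  rw [far_comm (a := .t (i - 1)) (b := b) hjb, t_mul_t j i]
  exact .far (.t i) b hjb _

/-- Solving the shorter equalities gives x = b τ b q and y = t_{j-1} b t_{j-2} q, and the index j
can then be traded for i. -/
theorem trans_t_near {i j : ℤ} {b : InfGen r} {x y : BInfPos r} (hjb : Near (.t j) b)
    (hn : len x < n) (h : g (.t (j - 1)) * x = g b * (g (.t j) * y)) :
    Ctl (.t i) (g (.t (i - 1)) * x) b (g (.t j) * (g b * y)) := by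
  have hl := congrArg len h
  simp only [len_g_mul] at hl
  obtain ⟨v, rfl, h1⟩ := (hK _ _ _ _ (by omega) h).exists_of_near (a := .t (j - 1)) hjb
  simp only [len_g_mul] at hl hn
  obtain ⟨p, rfl, h2⟩ := (hK _ _ _ _ (by omega) h1).exists_of_t (by omega)
  simp only [len_g_mul] at hl hn
  obtain ⟨q, rfl, rfl⟩ := (hK _ _ _ _ (by omega) h2).exists_of_near (b := .t (j - 1 - 1)) hjb.symm
  -- The right side is τ b τ q, hence independent of k.
  have key : ∀ k, g (.t k) * (g b * (g (.t (k - 1)) * (g b * (g (.t (k - 1 - 1)) * q)))) =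
      g (.t k) * (g (.t (k - 1)) * (g b * (g (.t (k - 1)) * (g (.t (k - 1 - 1)) * q)))) := fun k => by
    rw [near_braid (a := b) (b := .t (k - 1)) hjb.symm]
  rw [t_mul_t (j - 1) i, ← t_shift_near (i := i) hjb, key j, t_mul_t j i,
    t_mul_t (j - 1) (i - 1), ← key i]
  exact .near (.t i) b hjb _

/-- Comparing the two expressions of z produces an equality shorter than the one under study; it is
controlled by `hK`, and each pair of basic relations is settled separately. -/
theorem trans {a b c : InfGen r} {x y z : BInfPos r} (hn : len x ≤ n) (h : Ctl a x c z)
    (h' : Ctl c z b y) : Ctl a x b y := by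
  have hl := h.len_eq
  have hl' := h'.len_eq
  rcases h with _ | ⟨i, k, x⟩ | ⟨_, _, hac, x⟩ | ⟨_, _, hac, x⟩
  · exact h'
  · generalize hz : g (.t (k - 1)) * x = z at *
    rcases h' with _ | ⟨_, j, y⟩ | ⟨_, _, hcb, y⟩ | ⟨_, _, hcb, y⟩
    · subst hz
      exact .tt _ _ _
    · simp only [len_g_mul] at hn hl hl'
      rw [(hK _ _ _ _ (by omega) hz).eq_of_self]
      exact .tt _ _ _
    · simp only [len_g_mul] at hn hl hl'
      exact trans_t_far hK hcb (by omega) hz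
    · simp only [len_g_mul] at hn hl hl'
      exact trans_t_near hK hcb (by omega) hz
  · generalize hz : g a * x = z at *
    rcases h' with _ | ⟨_, j, y⟩ | ⟨_, _, hcb, y⟩ | ⟨_, _, hcb, y⟩
    · subst hz
      exact .far _ _ hac _
    · simp only [len_g_mul] at hn hl hl'
      exact (trans_t_far hK hac.symm (by omega) hz.symm).symm
    · simp only [len_g_mul] at hn hl hl'
      exact trans_far_far hK hac hcb (by omega) hz
    · simp only [len_g_mul] at hn hl hl'
      exact (trans_near_far hK hcb.symm hac.symm (by omega) hz.symm).symm
  · generalize hz : g a * (g c * x) = z at *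
    rcases h' with _ | ⟨_, j, y⟩ | ⟨_, _, hcb, y⟩ | ⟨_, _, hcb, y⟩
    · subst hz
      exact .near _ _ hac _
    · simp only [len_g_mul] at hn hl hl'
      exact (trans_t_near hK hac.symm (by omega) hz.symm).symm
    · simp only [len_g_mul] at hn hl hl'
      exact trans_near_far hK hac hcb (by omega) hz
    · simp only [len_g_mul] at hn hl hl'
      exact trans_near_near hK hac hcb (by omega) hz

end Transitivity

end Ctl

theorem ctl_of_eq : ∀ (a : InfGen r) x b y, g a * x = g b * y → Ctl a x b y := by
  refine PresentedMonoid.eq_control qRel_length Ctl ?_ Ctl.refl (fun _ _ _ _ => Ctl.symm)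
    (fun _ _ _ _ z h => h.mul_right z) (fun n hK a x c z b y hn h h' => Ctl.trans hK hn h h')
  rintro u v (⟨_, _, ⟨j, k, hjk⟩ | ⟨j, k, hjk⟩⟩ | ⟨i, j⟩ | ⟨j, hj, i⟩ | ⟨j, hj, i⟩)
  · refine ⟨_, _, _, _, rfl, rfl, ?_⟩
    have := Ctl.far (.s j) (.s k) (Or.inl hjk) 1
    rwa [mul_one, mul_one] at this
  · refine ⟨_, _, _, _, mul_assoc _ _ _, mul_assoc _ _ _, ?_⟩
    have := Ctl.near (.s j) (.s k) (Or.inr hjk) 1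
    rwa [mul_one, mul_one] at this
  · refine ⟨_, _, _, _, rfl, rfl, ?_⟩
    have := Ctl.tt (r := r) i j 1
    rwa [mul_one, mul_one] at this
  · refine ⟨_, _, _, _, mul_assoc _ _ _, mul_assoc _ _ _, ?_⟩
    have := Ctl.near (.s j) (.t i) (Or.inl hj) 1
    rwa [mul_one, mul_one] at this
  · refine ⟨_, _, _, _, rfl, rfl, ?_⟩
    have := Ctl.far (.s j) (.t i) (Or.inr hj) 1
    rwa [mul_one, mul_one] at this

/-- The control relation with equal first letters forces equal tails, so a can be removed letter by
letter. -/
theorem mul_left_cancel' (a b c : BInfPos r) (h : a * b = a * c) : b = c := by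
  obtain ⟨w, rfl⟩ := PresentedMonoid.surjective_mk a
  induction w using FreeMonoid.inductionOn' with
  | one => simpa using h
  | of_mul x w ih =>
    rw [map_mul, mul_assoc, mul_assoc] at h
    exact ih (ctl_of_eq x _ x _ h).eq_of_self

/-- The lcm is the common value of the basic relation: by control, every common multiple is a right
multiple of it. -/
theorem isRightLcm_letters (a b : InfGen r) (w : BInfPos r) (ha : g a ∣ w) (hb : g b ∣ w) :
    ∃ m, IsRightLcm (g a) (g b) m := by
  rcases letters_cases a b with rfl | ⟨i, j, hij, rfl, rfl⟩ | hab | hab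
  · exact ⟨_, dvd_refl _, dvd_refl _, fun _ h _ => h⟩
  · refine ⟨g (.t i) * (g (.t (i - 1)) * 1), Dvd.intro _ rfl, ?_, ?_⟩
    · rw [t_mul_t i j]
      exact Dvd.intro _ rfl
    · rintro _ ⟨x, rfl⟩ ⟨y, hy⟩
      obtain ⟨z, rfl, -⟩ := (ctl_of_eq _ _ _ _ hy).exists_of_t hij
      exact ⟨z, by simp only [mul_assoc, one_mul]⟩
  · refine ⟨g a * (g b * 1), Dvd.intro _ rfl, ?_, ?_⟩
    · rw [far_comm hab]
      exact Dvd.intro _ rfl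
    · rintro _ ⟨x, rfl⟩ ⟨y, hy⟩
      obtain ⟨z, rfl, -⟩ := (ctl_of_eq _ _ _ _ hy).exists_of_far hab
      exact ⟨z, by simp only [mul_assoc, one_mul]⟩
  · refine ⟨g a * (g b * (g a * 1)), Dvd.intro _ rfl, ?_, ?_⟩
    · rw [near_braid hab]
      exact Dvd.intro _ rfl
    · rintro _ ⟨x, rfl⟩ ⟨y, hy⟩
      obtain ⟨z, rfl, -⟩ := (ctl_of_eq _ _ _ _ hy).exists_of_near hab
      exact ⟨z, by simp only [mul_assoc, one_mul]⟩

/-- Elements of `B⁺(∞,∞,r)` with a common right multiple have a least one. -/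
theorem exists_isRightLcm {x y w : BInfPos r} (hx : x ∣ w) (hy : y ∣ w) :
    ∃ m, IsRightLcm x y m :=
  exists_isRightLcm_of_letters isLength_len mul_left_cancel' g (fun _ => rfl)
    (fun _ => PresentedMonoid.exists_eq_of_mul) isRightLcm_letters _ w x y le_rfl hx hy

end BInfPos

/-! ### Quasi-central elements -/

/-- `Δ x = y Δ` can be solved both for `x` and for `y`. -/
structure IsQuasiCentral {M : Type*} [Monoid M] (Δ : M) : Prop where
  exists_left : ∀ x, ∃ y, Δ * x = y * Δ
  exists_right : ∀ y, ∃ x, Δ * x = y * Δ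

namespace IsQuasiCentral

variable {M : Type*} [Monoid M]

theorem of_closure {Δ : M} {S : Set M} (hS : Submonoid.closure S = ⊤)
    (hl : ∀ x ∈ S, ∃ y, Δ * x = y * Δ) (hr : ∀ y ∈ S, ∃ x, Δ * x = y * Δ) :
    IsQuasiCentral Δ := by
  constructor
  · intro x
    have hx : x ∈ Submonoid.closure S := hS ▸ Submonoid.mem_top x
    induction hx using Submonoid.closure_induction with
    | mem x hx => exact hl x hx
    | one => exact ⟨1, by rw [mul_one, one_mul]⟩
    | mul x y _ _ ihx ihy =>
      obtain ⟨x', hx'⟩ := ihx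
      obtain ⟨y', hy'⟩ := ihy
      exact ⟨x' * y', by rw [← mul_assoc, hx', mul_assoc, hy', mul_assoc]⟩
  · intro x
    have hx : x ∈ Submonoid.closure S := hS ▸ Submonoid.mem_top x
    induction hx using Submonoid.closure_induction with
    | mem x hx => exact hr x hx
    | one => exact ⟨1, by rw [mul_one, one_mul]⟩
    | mul x y _ _ ihx ihy =>
      obtain ⟨x', hx'⟩ := ihx
      obtain ⟨y', hy'⟩ := ihy
      exact ⟨x' * y', by rw [← mul_assoc, hx', mul_assoc, hy', mul_assoc]⟩

variable {Δ : M} (hΔ : IsQuasiCentral Δ)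
include hΔ

theorem mul {Δ' : M} (hΔ' : IsQuasiCentral Δ') : IsQuasiCentral (Δ * Δ') := by
  constructor
  · intro x
    obtain ⟨y, hy⟩ := hΔ'.exists_left x
    obtain ⟨w, hw⟩ := hΔ.exists_left y
    exact ⟨w, by rw [mul_assoc, hy, ← mul_assoc, hw, mul_assoc]⟩
  · intro x
    obtain ⟨y, hy⟩ := hΔ.exists_right x
    obtain ⟨w, hw⟩ := hΔ'.exists_right y
    exact ⟨w, by rw [mul_assoc, hw, ← mul_assoc, hy, mul_assoc]⟩

theorem pow (n : ℕ) : IsQuasiCentral (Δ ^ n) := by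
  induction n with
  | zero =>
    rw [pow_zero]
    exact ⟨fun x => ⟨x, by rw [mul_one, one_mul]⟩, fun x => ⟨x, by rw [mul_one, one_mul]⟩⟩
  | succ n ih =>
    rw [pow_succ]
    exact ih.mul hΔ

/-- If Δ^k = x u and Δ^l = y v, moving u across Δ^l as u Δ^l = Δ^l u' gives Δ^(k+l) = x y v u'. -/
theorem exists_dvd_pow {S : Set M} (hS : Submonoid.closure S = ⊤) (hdvd : ∀ x ∈ S, x ∣ Δ) (x : M) :
    ∃ k, x ∣ Δ ^ k := by
  have hx : x ∈ Submonoid.closure S := hS ▸ Submonoid.mem_top x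
  induction hx using Submonoid.closure_induction with
  | mem x hx => exact ⟨1, by rw [pow_one]; exact hdvd x hx⟩
  | one => exact ⟨0, one_dvd _⟩
  | mul x y _ _ ihx ihy =>
    obtain ⟨k, u, hu⟩ := ihx
    obtain ⟨l, v, hv⟩ := ihy
    obtain ⟨u', hu'⟩ := (hΔ.pow l).exists_right u
    exact ⟨k + l, v * u', by
      rw [pow_add, hu, mul_assoc, ← hu', hv]; simp only [mul_assoc]⟩

theorem exists_common_multiple {S : Set M} (hS : Submonoid.closure S = ⊤)
    (hdvd : ∀ x ∈ S, x ∣ Δ) (x y : M) : ∃ w, x ∣ w ∧ y ∣ w := by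
  obtain ⟨k, hk⟩ := hΔ.exists_dvd_pow hS hdvd x
  obtain ⟨l, hl⟩ := hΔ.exists_dvd_pow hS hdvd y
  exact ⟨Δ ^ (k + l), hk.trans (pow_dvd_pow Δ (by omega)), hl.trans (pow_dvd_pow Δ (by omega))⟩

/-- If Δ = x y and Δ y = y' Δ, then x y y = y' x y, and cancelling y gives Δ = y' x; the converse is
symmetric. -/
theorem isGarsideElement (hl : ∀ a b c : M, a * b = a * c → b = c)
    (hr : ∀ a b c : M, b * a = c * a → b = c) {S : Set M} (hS : Submonoid.closure S = ⊤)
    (hdvd : ∀ x ∈ S, x ∣ Δ) : IsGarsideElement Δ where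
  left_iff_right x := by
    constructor
    · rintro ⟨y, rfl⟩
      obtain ⟨y', hy'⟩ := hΔ.exists_left y
      exact ⟨y', hr y _ _ (by rw [hy', mul_assoc])⟩
    · rintro ⟨y, rfl⟩
      obtain ⟨y', hy'⟩ := hΔ.exists_right y
      exact ⟨y', hl y _ _ (by rw [← mul_assoc y x y', hy'])⟩
  closure_eq_top := top_unique (hS ▸ Submonoid.closure_mono hdvd)

end IsQuasiCentral

/-! ### The element `Λ` -/

/-- The relations `(Q₁)`, `(Q₂)`, `(Q₃)` and the braid relations, with the letters `s₃, …, s_r`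
indexed by `0, …, n - 1`. -/
structure IsChainSystem {N : Type*} [Monoid N] (n : ℕ) (t : ℤ → N) (σ : ℕ → N) : Prop where
  comm : ∀ j k, j + 1 < k → k < n → σ j * σ k = σ k * σ j
  braid : ∀ j, j + 1 < n → σ j * σ (j + 1) * σ j = σ (j + 1) * σ j * σ (j + 1)
  q1 : ∀ i j, t i * t (i - 1) = t j * t (j - 1)
  q2 : 0 < n → ∀ i, σ 0 * t i * σ 0 = t i * σ 0 * t i
  q3 : ∀ j, 0 < j → j < n → ∀ i, σ j * t i = t i * σ j

/-- `σ_{m-1} ⋯ σ₀ t₁ t₀`. -/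
def chainElt {N : Type*} [Monoid N] (t : ℤ → N) (σ : ℕ → N) : ℕ → N
  | 0 => t 1 * t 0
  | m + 1 => σ m * chainElt t σ m

/-- `σ_a σ_{a+1} ⋯ σ_{a+k-1}`. -/
def ascProd {N : Type*} [Monoid N] (σ : ℕ → N) (a : ℕ) : ℕ → N
  | 0 => 1
  | k + 1 => ascProd σ a k * σ (a + k)

namespace IsChainSystem

variable {N : Type*} [Monoid N] {n : ℕ} {t : ℤ → N} {σ : ℕ → N} (h : IsChainSystem n t σ)
include h

local notation "D" => chainElt t σ

theorem tau (i : ℤ) : t 1 * t 0 = t i * t (i - 1) := h.q1 1 i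

theorem tau_mul_t (i : ℤ) : t 1 * t 0 * t i = t (i + 2) * (t 1 * t 0) := by
  have h1 := h.tau (i + 2)
  have h2 := h.tau (i + 1)
  rw [show i + 2 - 1 = i + 1 by ring] at h1
  rw [show i + 1 - 1 = i by ring] at h2
  rw [h1, mul_assoc, ← h2, ← h1]

/-- With τ written as t_{i+1} t_i, the braid relation of σ₀ applies first to t_i, then to t_{i+1}.
-/
theorem shift_zero (hn : 0 < n) (i : ℤ) :
    σ 0 * (t 1 * t 0) * σ 0 * t i = t (i + 1) * (σ 0 * (t 1 * t 0) * σ 0) := by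
  have h1 := h.tau (i + 1)
  rw [show i + 1 - 1 = i by ring] at h1
  calc σ 0 * (t 1 * t 0) * σ 0 * t i = σ 0 * t (i + 1) * (t i * σ 0 * t i) := by
        rw [h1]; simp only [mul_assoc]
    _ = (σ 0 * t (i + 1) * σ 0) * t i * σ 0 := by rw [← h.q2 hn]; simp only [mul_assoc]
    _ = _ := by rw [h.q2 hn, h1]; simp only [mul_assoc]

/-- Conjugation by σ₀ τ σ₀ sends t₁ t₀ to t₂ t₁, which is τ again. So τ and σ₀ satisfy the
length-four relation of type B. -/
theorem tau_braid (hn : 0 < n) :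
    σ 0 * (t 1 * t 0) * σ 0 * (t 1 * t 0) = (t 1 * t 0) * σ 0 * (t 1 * t 0) * σ 0 := by
  have h1 := h.shift_zero hn 1
  have h0 := h.shift_zero hn 0
  rw [show (1 : ℤ) + 1 = 2 by norm_num] at h1
  rw [show (0 : ℤ) + 1 = 1 by norm_num] at h0
  have h2 := h.tau 2
  rw [show (2 : ℤ) - 1 = 1 by norm_num] at h2
  rw [← mul_assoc _ (t 1) (t 0), h1, mul_assoc (t 2), h0, ← mul_assoc (t 2) (t 1), ← h2]
  simp only [mul_assoc]

theorem comm_tau {j : ℕ} (hj : 0 < j) (hjn : j < n) : σ j * (t 1 * t 0) = t 1 * t 0 * σ j := by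
  rw [← mul_assoc, h.q3 j hj hjn, mul_assoc, h.q3 j hj hjn, mul_assoc]

theorem comm_chainElt {m j : ℕ} (hmj : m < j) (hj : j < n) : σ j * D m = D m * σ j := by
  induction m with
  | zero => exact h.comm_tau hmj hj
  | succ m ih =>
    rw [chainElt, ← mul_assoc, ← h.comm m j hmj hj, mul_assoc, ih (by omega), mul_assoc]

theorem chainElt_mul {m j : ℕ} (hm : m ≤ n) (hj : j + 1 < m) : D m * σ (j + 1) = σ j * D m := by
  induction m with
  | zero => omega
  | succ m ih =>
    rcases Nat.lt_or_ge (j + 1) m with hjm | hjm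
    · rw [chainElt, mul_assoc, ih (by omega) hjm, ← mul_assoc, ← h.comm j m hjm (by omega),
        mul_assoc]
    · obtain rfl : m = j + 1 := by omega
      rw [chainElt, chainElt, mul_assoc, mul_assoc, ← h.comm_chainElt (by omega) (by omega),
        ← mul_assoc, ← mul_assoc, ← h.braid j (by omega)]
      simp only [mul_assoc]

theorem chainElt_mul_ascProd {m a k : ℕ} (hm : m ≤ n) (hak : a + k < m) :
    D m * ascProd σ (a + 1) k = ascProd σ a k * D m := by
  induction k with
  | zero => rw [ascProd, ascProd, one_mul, mul_one]
  | succ k ih =>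
    rw [ascProd, ascProd, ← mul_assoc, ih (by omega), mul_assoc, mul_assoc,
      show a + 1 + k = a + k + 1 by ring, h.chainElt_mul hm (by omega)]

/-- In each new factor σ_m D_m, the element D_m moves across the ascending product already collected
and lowers its indices by one, so that σ_m completes it. -/
theorem chainElt_pow {m k : ℕ} (hm : m < n) (hk : k ≤ m + 1) :
    D (m + 1) ^ k = ascProd σ (m + 1 - k) k * D m ^ k := by
  induction k with
  | zero => simp [ascProd]
  | succ k ih =>
    rw [pow_succ', ih (by omega), show m + 1 - k = (m - k) + 1 by omega, ← mul_assoc,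
      h.chainElt_mul_ascProd hm (by omega), show m + 1 - (k + 1) = m - k by omega, ascProd,
      show m - k + k = m by omega, chainElt, pow_succ' (D m)]
    simp only [mul_assoc]

/-- D lowers the index of σ by one; this is the wrap-around, in which two factors of D carry the
lowest letter to the highest. -/
theorem chainElt_sq_mul {m : ℕ} (hm : m < n) :
    D (m + 1) ^ 2 * σ 0 = σ m * D (m + 1) ^ 2 := by
  induction m with
  | zero =>
    have := h.tau_braid hm
    simp only [chainElt, pow_two, mul_assoc] at this ⊢
    rw [this]
  | succ m ih =>
    have key : D (m + 1 + 1) ^ 2 = σ m * σ (m + 1) * D (m + 1) ^ 2 := by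
      rw [h.chainElt_pow (by omega) (by omega), show m + 1 + 1 - 2 = m by omega]
      simp [ascProd]
    rw [key, mul_assoc, ih (by omega), ← mul_assoc, h.braid m hm]
    simp only [mul_assoc]

theorem chainElt_pow_mul {m k j : ℕ} (hm : m ≤ n) (hj : j + k < m) :
    D m ^ k * σ (j + k) = σ j * D m ^ k := by
  induction k with
  | zero => simp
  | succ k ih =>
    rw [pow_succ, mul_assoc, ← add_assoc, h.chainElt_mul hm (by omega), ← mul_assoc,
      ih (by omega), mul_assoc]

/-- A full turn: j factors lower σ_j to σ₀, two more turn it into σ_{m-1}, and the other m - 1 - j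
lower it back to σ_j. -/
theorem comm_chainElt_pow {m j : ℕ} (hm : m ≤ n) (hj : j < m) :
    D m ^ (m + 1) * σ j = σ j * D m ^ (m + 1) := by
  obtain ⟨k, rfl⟩ : ∃ k, m = j + k + 1 := ⟨m - j - 1, by omega⟩
  have h1 := h.chainElt_pow_mul (k := j) (j := 0) hm (by omega)
  have h2 := h.chainElt_pow_mul (k := k) (j := j) hm (by omega)
  rw [zero_add] at h1
  rw [show j + k + 1 + 1 = k + (2 + j) by ring, pow_add, pow_add, mul_assoc, mul_assoc, h1,
    ← mul_assoc (_ ^ 2), h.chainElt_sq_mul (by omega), mul_assoc, ← mul_assoc, h2, mul_assoc]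

/-- The first letter σ_{m-1} of the factor D after D^k, with k = m - 1 - j, emerges on the left of
D^k as σ_j. -/
theorem dvd_chainElt_pow {m j : ℕ} (hm : m ≤ n) (hj : j < m) : σ j ∣ D m ^ (m + 1) := by
  obtain ⟨k, rfl⟩ : ∃ k, m = j + k + 1 := ⟨m - j - 1, by omega⟩
  have h2 := h.chainElt_pow_mul (k := k) (j := j) hm (by omega)
  refine ⟨D (j + k + 1) ^ k * (D (j + k) * D (j + k + 1) ^ (j + 1)), ?_⟩
  rw [show j + k + 1 + 1 = k + (1 + (j + 1)) by ring, pow_add, pow_add _ 1, pow_one,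
    ← mul_assoc (σ j), ← h2]
  conv_lhs => rw [show D (j + k + 1) ^ k * (D (j + k + 1) * D (j + k + 1) ^ (j + 1)) =
    D (j + k + 1) ^ k * (σ (j + k) * D (j + k) * D (j + k + 1) ^ (j + 1)) from rfl]
  simp only [mul_assoc]

/-- The palindrome σ_m⋯σ₀ τ σ₀⋯σ_m is built outwards from `shift_zero`; the outer letters commute
with all t_i. -/
theorem shift {m : ℕ} (hm : m < n) (i : ℤ) :
    D (m + 1) * ascProd σ 0 (m + 1) * t i = t (i + 1) * (D (m + 1) * ascProd σ 0 (m + 1)) := by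
  induction m with
  | zero =>
    have := h.shift_zero hm i
    simpa [chainElt, ascProd, mul_assoc] using this
  | succ m ih =>
    have ih := ih (by omega)
    rw [chainElt, ascProd, zero_add]
    calc σ (m + 1) * D (m + 1) * (ascProd σ 0 (m + 1) * σ (m + 1)) * t i
        = σ (m + 1) * (D (m + 1) * ascProd σ 0 (m + 1) * t i) * σ (m + 1) := by
          simp only [mul_assoc]
          rw [h.q3 (m + 1) (by omega) hm]
      _ = _ := by
          rw [ih]
          simp only [← mul_assoc]
          rw [h.q3 (m + 1) (by omega) hm]

/-- This splits off one palindrome, so that the powers for successive m can be compared by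
induction. -/
theorem chainElt_pow_eq {m : ℕ} (hm : m < n) : D (m + 1) ^ (m + 1 + 1) =
    D (m + 1) * ascProd σ 0 (m + 1) * D m ^ (m + 1) := by
  rw [pow_succ', h.chainElt_pow hm le_rfl, Nat.sub_self, mul_assoc]

/-- The innermost factor τ shifts indices by 2, and each of the m palindromes by 1. -/
theorem chainElt_pow_mul_t {m : ℕ} (hm : m ≤ n) (i : ℤ) :
    D m ^ (m + 1) * t i = t (i + m + 2) * D m ^ (m + 1) := by
  induction m with
  | zero => simpa [chainElt] using h.tau_mul_t i
  | succ m ih =>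
    rw [h.chainElt_pow_eq hm, mul_assoc, ih (by omega), ← mul_assoc, h.shift hm, mul_assoc,
      show i + m + 2 + 1 = i + (m + 1 : ℕ) + 2 by push_cast; ring]

/-- By induction t_{i-1} can be extracted from the smaller power; crossing the palindrome turns it
into t_i. -/
theorem t_dvd_chainElt_pow {m : ℕ} (hm : m ≤ n) (i : ℤ) : t i ∣ D m ^ (m + 1) := by
  induction m generalizing i with
  | zero => exact ⟨t (i - 1), by simpa [chainElt] using h.tau i⟩
  | succ m ih =>
    obtain ⟨x, hx⟩ := ih (by omega) (i - 1)
    have := h.shift hm (i - 1)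
    rw [sub_add_cancel] at this
    rw [h.chainElt_pow_eq hm, hx, ← mul_assoc, this]
    simp only [mul_assoc]
    exact Dvd.intro _ rfl

end IsChainSystem

section Lambda

variable {N : Type*} [Monoid N] {r : ℕ}

/-- The letters `s₃, …, s_r`, indexed by `0, …, r - 3`. -/
def chainLetter (s : SIdx r → N) (m : ℕ) : N :=
  -- The value 1 outside the range is harmless: the chain relations and Λ only involve indices below
  -- r - 2.
  if h : m < r - 2 then s ⟨m + 3, by omega, by omega⟩ else 1

theorem chainLetter_eq (s : SIdx r → N) (j : SIdx r) : chainLetter s (j - 3) = s j := by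
  obtain ⟨j, hj⟩ := j
  rw [chainLetter, dif_pos (by simp only; omega)]
  congr 1
  exact Subtype.ext (by simp only; omega)

theorem IsQSystem.isChain {t : ℤ → N} {s : SIdx r → N} (h : IsQSystem t s) :
    IsChainSystem (r - 2) t (chainLetter s) where
  comm j k hjk hk := by
    rw [chainLetter, chainLetter, dif_pos hk, dif_pos (by omega)]
    exact h.comm _ _ (by simp only; omega)
  braid j hj := by
    rw [chainLetter, chainLetter, dif_pos hj, dif_pos (by omega)]
    exact h.braid _ _ rfl
  q1 := h.q1
  q2 hn i := by
    rw [chainLetter, dif_pos hn]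
    exact h.q2 _ rfl i
  q3 j hj hjn i := by
    rw [chainLetter, dif_pos hjn]
    exact h.q3 _ (by simp only; omega) i

/-- The element `Λ = (s_r ⋯ s₃ t₁ t₀)^{r-1}`. -/
def lambdaElt (t : ℤ → N) (s : SIdx r → N) : N :=
  chainElt t (chainLetter s) (r - 2) ^ (r - 1)

namespace IsQSystem

variable {t : ℤ → N} {s : SIdx r → N} (h : IsQSystem t s) (hr : 2 ≤ r)
include h hr

theorem lambdaElt_mul_s (j : SIdx r) : lambdaElt t s * s j = s j * lambdaElt t s := by
  have hj := j.2
  rw [← chainLetter_eq s, lambdaElt, show r - 1 = r - 2 + 1 by omega]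
  exact h.isChain.comm_chainElt_pow le_rfl (by omega)

theorem lambdaElt_mul_t (i : ℤ) : lambdaElt t s * t i = t (i + r) * lambdaElt t s := by
  have := h.isChain.chainElt_pow_mul_t le_rfl i
  rwa [show i + ((r - 2 : ℕ) : ℤ) + 2 = i + r by omega, show r - 2 + 1 = r - 1 by omega] at this

theorem s_dvd_lambdaElt (j : SIdx r) : s j ∣ lambdaElt t s := by
  have hj := j.2
  rw [← chainLetter_eq s, lambdaElt, show r - 1 = r - 2 + 1 by omega]
  exact h.isChain.dvd_chainElt_pow le_rfl (by omega)

theorem t_dvd_lambdaElt (i : ℤ) : t i ∣ lambdaElt t s := by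
  rw [lambdaElt, show r - 1 = r - 2 + 1 by omega]
  exact h.isChain.t_dvd_chainElt_pow le_rfl i

end IsQSystem

theorem chainElt_eq_prod (t : ℤ → N) (σ : ℕ → N) (m : ℕ) :
    chainElt t σ m =
      ((List.finRange m).reverse.map fun k : Fin m => σ k).prod * t 1 * t 0 := by
  induction m with
  | zero => simp [chainElt]
  | succ m ih =>
    rw [chainElt, ih, List.finRange_succ_last]
    simp [mul_assoc, Function.comp_def]

end Lambda

/-! ### Generators, common multiples and quasi-central elements -/

theorem BDeerPos.lam_eq (e r : ℕ) :
    BDeerPos.Lam e r = lambdaElt (BDeerPos.t e r) (BDeerPos.s e r) := by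
  rw [BDeerPos.Lam, lambdaElt, chainElt_eq_prod, BDeerPos.A]
  congr 5
  funext k
  rw [chainLetter, dif_pos k.2]

theorem BDeerPos.closure_eq_top (e r : ℕ) :
    Submonoid.closure ({BDeerPos.z e r} ∪ (Set.range (BDeerPos.t e r) ∪
      Set.range (BDeerPos.s e r))) = ⊤ := by
  refine top_unique (PresentedMonoid.closure_range_of (DeerRel e r) ▸ Submonoid.closure_mono ?_)
  rintro _ ⟨_ | i | j, rfl⟩
  · exact Or.inl rfl
  · exact Or.inr (Or.inl ⟨i, rfl⟩)
  · exact Or.inr (Or.inr ⟨j, rfl⟩)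

theorem BInfPos.closure_eq_top (r : ℕ) :
    Submonoid.closure (Set.range (BInfPos.t r) ∪ Set.range (BInfPos.s r)) = ⊤ := by
  refine top_unique (PresentedMonoid.closure_range_of (QRel InfGen.t InfGen.s) ▸
    Submonoid.closure_mono ?_)
  rintro _ ⟨i | j, rfl⟩
  · exact Or.inl ⟨i, rfl⟩
  · exact Or.inr ⟨j, rfl⟩

/-- Any two elements of `B⁺(∞,∞,r)` have a least common right multiple. -/
theorem BInfPos.exists_lcm {r : ℕ} (hr : 2 ≤ r) (x y : BInfPos r) : ∃ m, IsRightLcm x y m := by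
  have h := isQSystem_bInfPos r
  have hq : IsQuasiCentral (lambdaElt (BInfPos.t r) (BInfPos.s r)) := by
    refine .of_closure (BInfPos.closure_eq_top r) ?_ ?_
    · rintro _ (⟨i, rfl⟩ | ⟨j, rfl⟩)
      · exact ⟨_, h.lambdaElt_mul_t hr i⟩
      · exact ⟨_, h.lambdaElt_mul_s hr j⟩
    · rintro _ (⟨i, rfl⟩ | ⟨j, rfl⟩)
      · exact ⟨_, by rw [h.lambdaElt_mul_t hr (i - r), sub_add_cancel]⟩
      · exact ⟨_, h.lambdaElt_mul_s hr j⟩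
  obtain ⟨w, hx, hy⟩ := hq.exists_common_multiple (BInfPos.closure_eq_top r) (by
    rintro _ (⟨i, rfl⟩ | ⟨j, rfl⟩)
    · exact h.t_dvd_lambdaElt hr i
    · exact h.s_dvd_lambdaElt hr j) x y
  exact BInfPos.exists_isRightLcm hx hy

/-- Moving z across t₁ t₀ changes it into t_{1-e} t_{-e}, which is the same element; z also commutes
with the s_j. -/
theorem IsDSystem.commute_lambdaElt {N : Type*} [Monoid N] {e r : ℕ} {z : N} {t : ℤ → N}
    {s : SIdx r → N} (h : IsDSystem e z t s) : Commute z (lambdaElt t s) := by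
  refine Commute.pow_right ?_ _
  have h0 : Commute z (t 1 * t 0) := by
    have h1 := h.q4 1
    have h2 := h.q4 0
    rw [show (0 : ℤ) - e = 1 - e - 1 by ring] at h2
    rw [commute_iff_eq, ← mul_assoc, h1, mul_assoc, h2, ← mul_assoc, h.isChain.tau (1 - e)]
  have key : ∀ m, Commute z (chainElt t (chainLetter s) m) := by
    intro m
    induction m with
    | zero => exact h0
    | succ m ih =>
      refine Commute.mul_right ?_ ih
      rw [chainLetter]
      split_ifs
      · exact h.q5 _
      · exact Commute.one_right z
  exact key _

theorem BDeerPos.isQuasiCentral {r : ℕ} (e : ℕ) (hr : 2 ≤ r) (p q : ℕ) :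
    IsQuasiCentral (BDeerPos.z e r ^ p * BDeerPos.Lam e r ^ q) := by
  have h := isDSystem_bDeerPos e r
  rw [BDeerPos.lam_eq]
  refine .mul (.pow ?_ p) (.pow ?_ q)
  · refine .of_closure (BDeerPos.closure_eq_top e r) ?_ ?_
    · rintro _ (rfl | ⟨i, rfl⟩ | ⟨j, rfl⟩)
      · exact ⟨_, rfl⟩
      · exact ⟨_, h.q4 i⟩
      · exact ⟨_, h.q5 j⟩
    · rintro _ (rfl | ⟨i, rfl⟩ | ⟨j, rfl⟩)
      · exact ⟨_, rfl⟩
      · exact ⟨_, by rw [h.q4 (i + e), add_sub_cancel_right]⟩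
      · exact ⟨_, h.q5 j⟩
  · refine .of_closure (BDeerPos.closure_eq_top e r) ?_ ?_
    · rintro _ (rfl | ⟨i, rfl⟩ | ⟨j, rfl⟩)
      · exact ⟨_, h.commute_lambdaElt.symm⟩
      · exact ⟨_, h.lambdaElt_mul_t hr i⟩
      · exact ⟨_, h.lambdaElt_mul_s hr j⟩
    · rintro _ (rfl | ⟨i, rfl⟩ | ⟨j, rfl⟩)
      · exact ⟨_, h.commute_lambdaElt.symm⟩
      · exact ⟨_, by rw [h.lambdaElt_mul_t hr (i - r), sub_add_cancel]⟩
      · exact ⟨_, h.lambdaElt_mul_s hr j⟩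

/-- The letters t_i and s_j divide Λ, which can be brought to the front because it commutes with z.
-/
theorem BDeerPos.dvd_garside {r : ℕ} (e : ℕ) (hr : 2 ≤ r) {p q : ℕ} (hp : 0 < p) (hq : 0 < q) :
    ∀ x ∈ {BDeerPos.z e r} ∪ (Set.range (BDeerPos.t e r) ∪ Set.range (BDeerPos.s e r)),
      x ∣ BDeerPos.z e r ^ p * BDeerPos.Lam e r ^ q := by
  have h := isDSystem_bDeerPos e r
  rw [BDeerPos.lam_eq]
  have hΛ := (dvd_pow_self (lambdaElt (BDeerPos.t e r) (BDeerPos.s e r)) hq.ne').mul_right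
    (BDeerPos.z e r ^ p)
  rw [← (h.commute_lambdaElt.pow_pow p q).eq] at hΛ
  rintro _ (rfl | ⟨i, rfl⟩ | ⟨j, rfl⟩)
  · exact (dvd_pow_self _ hp.ne').mul_right _
  · exact (h.t_dvd_lambdaElt hr i).trans hΛ
  · exact (h.s_dvd_lambdaElt hr j).trans hΛ

/-! ### The elements `t_i` of a group -/

section TSeq

variable {G : Type*} [Group G]

theorem tSeq_zero (a b : G) : tSeq a b 0 = a := by simp [tSeq]

theorem tSeq_one (a b : G) : tSeq a b 1 = b := by simp [tSeq]

theorem map_tSeq {H : Type*} [Group H] (f : G →* H) (a b : G) (i : ℤ) :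
    f (tSeq a b i) = tSeq (f a) (f b) i := by
  simp only [tSeq, map_mul, map_inv, map_zpow, apply_ite f]

theorem tSeq_mul_tSeq (a b : G) (i : ℤ) : tSeq a b i * tSeq a b (i - 1) = b * a := by
  rcases Int.even_or_odd' i with ⟨m, rfl | rfl⟩
  · rw [tSeq, tSeq, show 2 * m / 2 = m by omega, show (2 * m - 1) / 2 = m - 1 by omega,
      if_pos (by omega), if_neg (by omega), zpow_sub_one]
    group
  · rw [tSeq, tSeq, show (2 * m + 1) / 2 = m by omega, show (2 * m + 1 - 1) / 2 = m by omega,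
      if_neg (by omega), if_pos (by omega)]
    have := (Commute.self_zpow (b * a) m).eq
    rw [mul_assoc _ a, ← mul_assoc, inv_mul_cancel_right, mul_assoc, ← mul_assoc b, ← mul_assoc,
      ← this, mul_inv_cancel_right]

/-- A sequence in which the product of consecutive elements is constant is determined by one
element. -/
theorem eq_of_mul_const {u v : ℤ → G} {c : G} (hu : ∀ i, u i * u (i - 1) = c)
    (hv : ∀ i, v i * v (i - 1) = c) (h0 : u 0 = v 0) (i : ℤ) : u i = v i := by
  induction i using Int.induction_on with
  | zero => exact h0
  | succ i ih =>
    have h1 := hu (i + 1)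
    have h2 := hv (i + 1)
    rw [add_sub_cancel_right] at h1 h2
    rw [← h2, ih] at h1
    exact mul_right_cancel h1
  | pred i ih =>
    have h1 := hu (-i)
    rw [← hv (-i), ih] at h1
    exact mul_left_cancel h1

theorem eq_tSeq {u : ℤ → G} (hu : ∀ i, u i * u (i - 1) = u 1 * u 0) (i : ℤ) :
    u i = tSeq (u 0) (u 1) i :=
  eq_of_mul_const hu (tSeq_mul_tSeq _ _) (tSeq_zero _ _).symm i

end TSeq

/-! ### Passing from one system of relations to the other -/

theorem IsQSystem.map {N N' : Type*} [Monoid N] [Monoid N'] {r : ℕ} {t : ℤ → N} {s : SIdx r → N}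
    (h : IsQSystem t s) (f : N →* N') : IsQSystem (fun i => f (t i)) (fun j => f (s j)) where
  comm j k hjk := by simp only [← map_mul, h.comm j k hjk]
  braid j k hjk := by simp only [← map_mul, h.braid j k hjk]
  q1 i j := by simp only [← map_mul, h.q1 i j]
  q2 j hj i := by simp only [← map_mul, h.q2 j hj i]
  q3 j hj i := by simp only [← map_mul, h.q3 j hj i]

theorem IsDSystem.map {N N' : Type*} [Monoid N] [Monoid N'] {e r : ℕ} {z : N} {t : ℤ → N}
    {s : SIdx r → N} (h : IsDSystem e z t s) (f : N →* N') :
    IsDSystem e (f z) (fun i => f (t i)) (fun j => f (s j)) where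
  toIsQSystem := h.toIsQSystem.map f
  q4 i := by simp only [← map_mul, h.q4 i]
  q5 j := by simp only [← map_mul, h.q5 j]

theorem IsQSystem.shift {N : Type*} [Monoid N] {r : ℕ} {t : ℤ → N} {s : SIdx r → N}
    (h : IsQSystem t s) (k : ℤ) : IsQSystem (fun i => t (i + k)) s where
  comm := h.comm
  braid := h.braid
  q1 i j := by
    simp only [show ∀ i : ℤ, i - 1 + k = i + k - 1 from fun i => by ring]
    exact h.q1 _ _
  q2 j hj i := h.q2 j hj _
  q3 j hj i := h.q3 j hj _

theorem IsQSystem.isPSystem {N : Type*} [Monoid N] {r : ℕ} {t : ℤ → N} {s : SIdx r → N}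
    (h : IsQSystem t s) : IsPSystem (t 0) (t 1) s where
  comm := h.comm
  braid := h.braid
  p2_zero j hj := h.q2 j hj 0
  p2_one j hj := h.q2 j hj 1
  p3_zero j hj := h.q3 j hj 0
  p3_one j hj := h.q3 j hj 1
  p4 j hj := by
    have hr := j.2.2
    have := h.isChain.tau_braid (by omega)
    have h0 : chainLetter s 0 = s j := by rw [← chainLetter_eq s j, hj]
    rwa [h0] at this

/-- If `s` satisfies the braid relation with `b` and `c`, where `a b = b c`, and the relation of
length four with `a b`, then it satisfies the braid relation with `a` if and only if it does so
with `c`. -/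
theorem braid_iff_braid {G : Type*} [Group G] {s a b c : G} (habc : a * b = b * c)
    (hb : s * b * s = b * s * b)
    (h4 : s * (a * b) * s * (a * b) = (a * b) * s * (a * b) * s) :
    s * a * s = a * s * a ↔ s * c * s = c * s * c := by
  have hb' : ∀ x, s * (b * (s * x)) = b * (s * (b * x)) := fun x => by
    simp only [← mul_assoc, hb]
  have habc' : ∀ x, a * (b * x) = b * (c * x) := fun x => by
    simp only [← mul_assoc, habc]
  simp only [mul_assoc] at h4
  constructor
  · intro ha
    have ha' : ∀ x, s * (a * (s * x)) = a * (s * (a * x)) := fun x => by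
      simp only [← mul_assoc, ha]
    -- The two sides of the length-four relation acquire the common prefix a s b; cancelling it
    -- leaves c s c = s c s.
    have e1 : s * (a * (b * (s * (a * b)))) = a * (s * (b * (c * (s * c)))) := by
      rw [habc, ← hb', ha', habc']
    have e2 : a * (b * (s * (a * (b * s)))) = a * (s * (b * (s * (c * s)))) := by
      rw [habc' s, ← hb']
    rw [e1, e2] at h4
    have := mul_left_cancel (mul_left_cancel (mul_left_cancel h4))
    rw [mul_assoc, mul_assoc, this]
  · intro hcc
    rw [mul_assoc, mul_assoc] at hcc
    -- Now the common part is the suffix b s c, leaving s a s = a s a.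
    have e1 : s * (a * (b * (s * (a * b)))) = s * (a * (s * (b * (s * c)))) := by
      rw [habc, ← hb']
    have e2 : a * (b * (s * (a * (b * s)))) = a * (s * (a * (b * (s * c)))) := by
      rw [habc' s, ← hb', hcc, ← habc']
    rw [e1, e2] at h4
    have h5 : (s * a * s) * (b * (s * c)) = (a * s * a) * (b * (s * c)) := by
      simp only [mul_assoc, h4]
    exact mul_right_cancel h5

theorem IsPSystem.isQSystem {G : Type*} [Group G] {r : ℕ} {t₀ t₁ : G} {s : SIdx r → G}
    (h : IsPSystem t₀ t₁ s) : IsQSystem (tSeq t₀ t₁) s where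
  comm := h.comm
  braid := h.braid
  q1 i j := by rw [tSeq_mul_tSeq, tSeq_mul_tSeq]
  q2 j hj := by
    -- The triple t_{i+1}, t_i, t_{i-1} plays the role of a, b, c in `braid_iff_braid`, as t_{i+1}
    -- t_i = t_i t_{i-1}.
    have hstep : ∀ i, s j * tSeq t₀ t₁ i * s j = tSeq t₀ t₁ i * s j * tSeq t₀ t₁ i →
        (s j * tSeq t₀ t₁ (i + 1) * s j = tSeq t₀ t₁ (i + 1) * s j * tSeq t₀ t₁ (i + 1) ↔
        s j * tSeq t₀ t₁ (i - 1) * s j = tSeq t₀ t₁ (i - 1) * s j * tSeq t₀ t₁ (i - 1)) := by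
      intro i hi
      have h1 := tSeq_mul_tSeq t₀ t₁ (i + 1)
      rw [add_sub_cancel_right] at h1
      refine braid_iff_braid ?_ hi ?_
      · rw [h1, tSeq_mul_tSeq]
      · rw [h1]
        exact h.p4 j hj
    -- Each step needs two neighbouring indices, so the induction carries consecutive pairs.
    have key : ∀ i, s j * tSeq t₀ t₁ i * s j = tSeq t₀ t₁ i * s j * tSeq t₀ t₁ i ∧
        s j * tSeq t₀ t₁ (i + 1) * s j = tSeq t₀ t₁ (i + 1) * s j * tSeq t₀ t₁ (i + 1) := by
      intro i
      induction i using Int.induction_on with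
      | zero =>
        rw [zero_add, tSeq_zero, tSeq_one]
        exact ⟨h.p2_zero j hj, h.p2_one j hj⟩
      | succ i ih =>
        refine ⟨ih.2, (hstep _ ih.2).2 ?_⟩
        rw [add_sub_cancel_right]
        exact ih.1
      | pred i ih =>
        rw [sub_add_cancel]
        exact ⟨(hstep _ ih.1).1 ih.2, ih.1⟩
    exact fun i => (key i).1
  q3 j hj i := by
    have h0 : Commute (s j) t₀ := h.p3_zero j hj
    have h1 : Commute (s j) t₁ := h.p3_one j hj
    have h2 := (h1.mul_right h0).zpow_right (i / 2)
    refine ((h2.mul_right ?_).mul_right h2.inv_right).eq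
    split_ifs
    exacts [h0, h1]

/-- This makes the alternating relation amount to z t_e = t₀ z after right cancellation. The
induction goes by two because τ shifts indices by two. -/
theorem IsQSystem.lift_altWord {N : Type*} [Monoid N] {r : ℕ} {t : ℤ → N} {s : SIdx r → N}
    (h : IsQSystem t s) (k : ℕ) :
    FreeMonoid.lift (fun b : Bool => cond b (t 1) (t 0)) (altWord true false (k + 1)) =
      t (k + 1) * FreeMonoid.lift (fun b : Bool => cond b (t 1) (t 0)) (altWord true false k) := by
  induction k using Nat.twoStepInduction with
  | zero => simp [altWord]
  | one =>
    have := h.q1 1 2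
    norm_num at this
    simpa [altWord] using this
  | more k ih _ =>
    rw [altWord, altWord, map_mul, map_mul, ih]
    conv_rhs => rw [altWord, altWord, map_mul, map_mul]
    simp only [FreeMonoid.lift_eval_of, cond_true, cond_false]
    have := h.isChain.tau_mul_t (k + 1)
    rw [← mul_assoc, ← mul_assoc, this, show ((k + 2 : ℕ) : ℤ) + 1 = k + 1 + 2 by push_cast; ring]
    simp only [mul_assoc]

theorem IsDSystem.isBMRSystem {N : Type*} [Monoid N] {e r : ℕ} (he : 1 ≤ e) {z : N} {t : ℤ → N}
    {s : SIdx r → N} (h : IsDSystem e z t s) : IsBMRSystem e z (t 0) (t 1) s where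
  toIsPSystem := h.isPSystem
  r1 := by
    have := h.q4 0
    have h1 := h.q1 (1 - e) 1
    rw [h.q4 1, mul_assoc, this, ← mul_assoc, show (0 : ℤ) - e = 1 - e - 1 by ring, h1]
    rfl
  r2 := by
    obtain ⟨k, rfl⟩ : ∃ k, e = k + 1 := ⟨e - 1, by omega⟩
    have := h.q4 (k + 1)
    rw [show (k : ℤ) + 1 - (k + 1 : ℕ) = 0 by push_cast; ring] at this
    rw [h.lift_altWord, ← mul_assoc, this, Nat.add_sub_cancel]
  r3 := h.q5

theorem IsBMRSystem.isDSystem {G : Type*} [Group G] {e r : ℕ} (he : 1 ≤ e) {z t₀ t₁ : G}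
    {s : SIdx r → G} (h : IsBMRSystem e z t₀ t₁ s) : IsDSystem e z (tSeq t₀ t₁) s where
  toIsQSystem := h.isQSystem
  q4 i := by
    obtain ⟨k, rfl⟩ : ∃ k, e = k + 1 := ⟨e - 1, by omega⟩
    have hQ := h.isQSystem
    have h2 := h.r2
    have hz : z * (t₁ * t₀) * z⁻¹ = t₁ * t₀ := by
      rw [← mul_assoc, h.r1, mul_inv_cancel_right]
    have ha := hQ.lift_altWord k
    rw [tSeq_zero, tSeq_one] at ha
    rw [ha, Nat.add_sub_cancel, ← mul_assoc] at h2
    have h3 := mul_right_cancel h2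
    -- The sequence z t_{i+e} z⁻¹ has consecutive products τ, since z commutes with τ, and its value
    -- at 0 is t₀; hence it is the sequence t_i itself.
    have key := eq_of_mul_const (u := fun i => z * tSeq t₀ t₁ (i + (k + 1)) * z⁻¹)
      (v := tSeq t₀ t₁) (c := t₁ * t₀) (fun i => by
        rw [show i - 1 + ((k : ℤ) + 1) = i + (k + 1) - 1 by ring, ← hz,
          ← tSeq_mul_tSeq t₀ t₁ (i + (k + 1))]
        group) (tSeq_mul_tSeq _ _) (by
        rw [zero_add, h3, mul_inv_cancel_right, tSeq_zero]) (i - (k + 1 : ℕ))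
    rw [← key, show i - ((k + 1 : ℕ) : ℤ) + (k + 1) = i by push_cast; ring, inv_mul_cancel_right]
  q5 := h.r3

/-! ### Universal properties -/

theorem isQSystem_bInf (r : ℕ) : IsQSystem (BInf.t r) (BInf.s r) :=
  ((pRel_lift_iff _ _ _ _).1 PosGroup.lift_gen_eq_of_rel).isQSystem

theorem isDSystem_bDeer (d r : ℕ) {e : ℕ} (he : 1 ≤ e) :
    IsDSystem e (BDeer.z d e r) (BDeer.t d e r) (BDeer.s d e r) :=
  ((bmrRel_lift_iff e _).1 PosGroup.lift_gen_eq_of_rel).isDSystem he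

theorem isDSystem_posGroup (e r : ℕ) :
    IsDSystem e (PosGroup.gen (DeerRel e r) .z) (fun i => PosGroup.gen (DeerRel e r) (.t i))
      (fun j => PosGroup.gen (DeerRel e r) (.s j)) :=
  (deerRel_lift_iff e _).1 PosGroup.lift_gen_eq_of_rel

namespace BInf

variable {G : Type*} [Group G] {r : ℕ}

theorem exists_lift {t : ℤ → G} {s : SIdx r → G} (h : IsQSystem t s) :
    ∃ f : BInf r →* G, (∀ i, f (BInf.t r i) = t i) ∧ ∀ j, f (BInf.s r j) = s j := by
  let φ : ShiGen r → G := fun a => match a with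
    | .t₀ => t 0
    | .t₁ => t 1
    | .s j => s j
  refine ⟨PosGroup.lift φ ((pRel_lift_iff φ _ _ _).2 h.isPSystem), fun i => ?_, fun j => ?_⟩
  · rw [BInf.t, map_tSeq, PosGroup.lift_gen, PosGroup.lift_gen]
    exact (eq_tSeq (fun i => h.q1 i 1) i).symm
  · exact PosGroup.lift_gen _ _ _

theorem hom_ext {f g : BInf r →* G} (ht : ∀ i, f (BInf.t r i) = g (BInf.t r i))
    (hs : ∀ j, f (BInf.s r j) = g (BInf.s r j)) : f = g := by
  refine PresentedGroup.ext ?_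
  rintro (_ | _ | j)
  · simpa only [BInf.t, tSeq_zero] using ht 0
  · simpa only [BInf.t, tSeq_one] using ht 1
  · exact hs j

end BInf

namespace BDeer

variable {G : Type*} [Group G] {d e r : ℕ}

theorem exists_lift (he : 1 ≤ e) {z : G} {t : ℤ → G} {s : SIdx r → G} (h : IsDSystem e z t s) :
    ∃ f : BDeer d e r →* G, f (BDeer.z d e r) = z ∧ (∀ i, f (BDeer.t d e r i) = t i) ∧
      ∀ j, f (BDeer.s d e r j) = s j := by
  let φ : BMRGen r → G := fun a => match a with
    | .z => z
    | .t₀ => t 0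
    | .t₁ => t 1
    | .s j => s j
  refine ⟨PosGroup.lift φ ((bmrRel_lift_iff e φ).2 (h.isBMRSystem he)), ?_, fun i => ?_,
    fun j => ?_⟩
  · exact PosGroup.lift_gen _ _ _
  · rw [BDeer.t, map_tSeq, PosGroup.lift_gen, PosGroup.lift_gen]
    exact (eq_tSeq (fun i => h.q1 i 1) i).symm
  · exact PosGroup.lift_gen _ _ _

theorem hom_ext {f g : BDeer d e r →* G} (hz : f (BDeer.z d e r) = g (BDeer.z d e r))
    (ht : ∀ i, f (BDeer.t d e r i) = g (BDeer.t d e r i))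
    (hs : ∀ j, f (BDeer.s d e r j) = g (BDeer.s d e r j)) : f = g := by
  refine PresentedGroup.ext ?_
  rintro (_ | _ | _ | j)
  · exact hz
  · simpa only [BDeer.t, tSeq_zero] using ht 0
  · simpa only [BDeer.t, tSeq_one] using ht 1
  · exact hs j

end BDeer

namespace BInfPos

variable {N : Type*} [Monoid N] {r : ℕ}

theorem exists_lift {t : ℤ → N} {s : SIdx r → N} (h : IsQSystem t s) :
    ∃ f : BInfPos r →* N, (∀ i, f (BInfPos.t r i) = t i) ∧ ∀ j, f (BInfPos.s r j) = s j := by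
  let φ : InfGen r → N := fun a => match a with
    | .t i => t i
    | .s j => s j
  exact ⟨PresentedMonoid.lift φ ((qRel_lift_iff φ _ _).2 h), fun i => rfl, fun j => rfl⟩

theorem hom_ext {f g : BInfPos r →* N} (ht : ∀ i, f (BInfPos.t r i) = g (BInfPos.t r i))
    (hs : ∀ j, f (BInfPos.s r j) = g (BInfPos.s r j)) : f = g := by
  refine PresentedMonoid.ext _ ?_
  rintro (i | j)
  · exact ht i
  · exact hs j

end BInfPos

namespace BDeerPos

variable {N : Type*} [Monoid N] {e r : ℕ}

theorem exists_lift {z : N} {t : ℤ → N} {s : SIdx r → N} (h : IsDSystem e z t s) :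
    ∃ f : BDeerPos e r →* N, f (BDeerPos.z e r) = z ∧ (∀ i, f (BDeerPos.t e r i) = t i) ∧
      ∀ j, f (BDeerPos.s e r j) = s j := by
  let φ : DeerGen r → N := fun a => match a with
    | .z => z
    | .t i => t i
    | .s j => s j
  exact ⟨PresentedMonoid.lift φ ((deerRel_lift_iff e φ).2 h), rfl, fun i => rfl, fun j => rfl⟩

theorem hom_ext {f g : BDeerPos e r →* N} (hz : f (BDeerPos.z e r) = g (BDeerPos.z e r))
    (ht : ∀ i, f (BDeerPos.t e r i) = g (BDeerPos.t e r i))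
    (hs : ∀ j, f (BDeerPos.s e r j) = g (BDeerPos.s e r j)) : f = g := by
  refine PresentedMonoid.ext _ ?_
  rintro (_ | i | j)
  · exact hz
  · exact ht i
  · exact hs j

end BDeerPos

/-- The presentation with the generators `z`, `t_i` and `s_j` is a presentation of
`B(de,e,r)`. -/
theorem exists_equiv_posGroup (d r : ℕ) {e : ℕ} (he : 1 ≤ e) :
    ∃ θ : PosGroup (DeerRel e r) ≃* BDeer d e r,
      θ (PosGroup.gen _ DeerGen.z) = BDeer.z d e r ∧
      (∀ i : ℤ, θ (PosGroup.gen _ (DeerGen.t i)) = BDeer.t d e r i) ∧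
      ∀ j : SIdx r, θ (PosGroup.gen _ (DeerGen.s j)) = BDeer.s d e r j := by
  let φ : DeerGen r → BDeer d e r := fun a => match a with
    | .z => BDeer.z d e r
    | .t i => BDeer.t d e r i
    | .s j => BDeer.s d e r j
  let f := PosGroup.lift φ ((deerRel_lift_iff e φ).2 (isDSystem_bDeer d r he))
  have hf : ∀ a, f (PosGroup.gen _ a) = φ a := PosGroup.lift_gen φ _
  obtain ⟨g, hz, ht, hs⟩ := BDeer.exists_lift (d := d) he (isDSystem_posGroup e r)
  refine ⟨MonoidHom.toMulEquiv f g ?_ ?_, hf .z, fun i => hf (.t i), fun j => hf (.s j)⟩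
  · refine PresentedGroup.ext ?_
    intro a
    change g (f (PosGroup.gen _ a)) = PosGroup.gen _ a
    rw [hf]
    rcases a with _ | i | j
    exacts [hz, ht i, hs j]
  · refine BDeer.hom_ext ?_ (fun i => ?_) (fun j => ?_)
    · change f (g _) = _
      rw [hz, hf]
      rfl
    · change f (g _) = _
      rw [ht, hf]
      rfl
    · change f (g _) = _
      rw [hs, hf]
      rfl

/-! ### Infinite cyclic groups and monoids -/

theorem CInfE.coe_z_zpow (e : ℕ) (n : ℤ) :
    ((CInfE.z e ^ n : CInfE e) : CInf) = Multiplicative.ofAdd (e * n) := by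
  change (Multiplicative.ofAdd (1 : ℤ) ^ e) ^ n = _
  rw [← ofAdd_nsmul, ← ofAdd_zsmul]
  simp [mul_comm]

theorem CInfE.exists_eq_zpow {e : ℕ} (g : CInfE e) : ∃ n : ℤ, g = CInfE.z e ^ n := by
  obtain ⟨n, hn⟩ := Subgroup.mem_zpowers_iff.1 g.2
  exact ⟨n, Subtype.ext (by rw [SubgroupClass.coe_zpow, ← hn]; rfl)⟩

theorem CInfE.zpow_injective {e : ℕ} (he : 1 ≤ e) :
    Function.Injective fun n : ℤ => CInfE.z e ^ n := by
  intro m n hmn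
  have h := congrArg (fun g : CInfE e => Multiplicative.toAdd (g : CInf)) hmn
  simp only [CInfE.coe_z_zpow, toAdd_ofAdd] at h
  exact Int.eq_of_mul_eq_mul_left (by omega) h

/-- For e ≥ 1 the subgroup is infinite cyclic, hence free on its generator. -/
theorem CInfE.exists_hom {e : ℕ} (he : 1 ≤ e) {G : Type*} [Group G] (x : G) :
    ∃ f : CInfE e →* G, f (CInfE.z e) = x := by
  let φ : Multiplicative ℤ ≃* CInfE e := MulEquiv.ofBijective (zpowersHom _ (CInfE.z e))
    ⟨fun m n h => CInfE.zpow_injective he h, fun g => by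
      obtain ⟨n, rfl⟩ := CInfE.exists_eq_zpow g
      exact ⟨Multiplicative.ofAdd n, rfl⟩⟩
  have hφ : φ (Multiplicative.ofAdd 1) = CInfE.z e := zpow_one _
  refine ⟨(zpowersHom G x).comp φ.symm.toMonoidHom, ?_⟩
  rw [← hφ]
  simp

/-- The generator of `(C_∞^e)⁺`. -/
abbrev CInfEPos.z (e : ℕ) : CInfEPos e := ⟨CInfE.z e, Submonoid.mem_powers (CInfE.z e)⟩

theorem CInfEPos.exists_eq_pow {e : ℕ} (g : CInfEPos e) : ∃ n : ℕ, g = CInfEPos.z e ^ n := by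
  obtain ⟨n, hn⟩ := (Submonoid.mem_powers_iff _ _).1 g.2
  exact ⟨n, Subtype.ext (by rw [SubmonoidClass.coe_pow, ← hn])⟩

theorem CInfEPos.pow_injective {e : ℕ} (he : 1 ≤ e) :
    Function.Injective fun n : ℕ => CInfEPos.z e ^ n := by
  intro m n hmn
  have h := congrArg (fun g : CInfEPos e => (g : CInfE e)) hmn
  simp only [SubmonoidClass.coe_pow] at h
  exact_mod_cast CInfE.zpow_injective he (a₁ := m) (a₂ := n) (by simpa using h)

theorem CInfEPos.exists_hom {e : ℕ} (he : 1 ≤ e) {N : Type*} [Monoid N] (x : N) :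
    ∃ f : CInfEPos e →* N, f (CInfEPos.z e) = x := by
  let φ : Multiplicative ℕ ≃* CInfEPos e := MulEquiv.ofBijective (powersHom _ (CInfEPos.z e))
    ⟨fun m n h => CInfEPos.pow_injective he h, fun g => by
      obtain ⟨n, rfl⟩ := CInfEPos.exists_eq_pow g
      exact ⟨Multiplicative.ofAdd n, rfl⟩⟩
  have hφ : φ (Multiplicative.ofAdd 1) = CInfEPos.z e := pow_one _
  refine ⟨(powersHom N x).comp φ.symm.toMonoidHom, ?_⟩
  rw [← hφ]
  simp

/-! ### The actions of `C_∞` -/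

theorem exists_action {N : Type*} [Monoid N] (F : ℤ → N →* N) (h0 : F 0 = MonoidHom.id N)
    (hadd : ∀ m n, F (m + n) = (F m).comp (F n)) :
    ∃ ρ : CInf →* MulAut N, ∀ n x, ρ (Multiplicative.ofAdd n) x = F n x := by
  refine ⟨MonoidHom.mk' (fun n => MonoidHom.toMulEquiv (F n.toAdd) (F (-n.toAdd))
    (by rw [← hadd, neg_add_cancel, h0]) (by rw [← hadd, add_neg_cancel, h0])) ?_, ?_⟩
  · intro m n
    ext x
    exact DFunLike.congr_fun (hadd _ _) x
  · exact fun n x => rfl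

theorem BInf.exists_shift (r : ℕ) : ∃ ρ : CInf →* MulAut (BInf r),
    (∀ n i, ρ (Multiplicative.ofAdd n) (BInf.t r i) = BInf.t r (i - n)) ∧
      ∀ n j, ρ (Multiplicative.ofAdd n) (BInf.s r j) = BInf.s r j := by
  choose F ht hs using fun n : ℤ => BInf.exists_lift ((isQSystem_bInf r).shift (-n))
  obtain ⟨ρ, hρ⟩ := exists_action F
    (BInf.hom_ext (fun i => by simp [ht]) (fun j => by simp [hs]))
    (fun m n => BInf.hom_ext (fun i => by simp [ht]; congr 1; ring) (fun j => by simp [hs]))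
  exact ⟨ρ, fun n i => by rw [hρ, ht]; rfl, fun n j => by rw [hρ, hs]⟩

theorem BInfPos.exists_shift (r : ℕ) : ∃ ρ : CInf →* MulAut (BInfPos r),
    (∀ n i, ρ (Multiplicative.ofAdd n) (BInfPos.t r i) = BInfPos.t r (i - n)) ∧
      ∀ n j, ρ (Multiplicative.ofAdd n) (BInfPos.s r j) = BInfPos.s r j := by
  choose F ht hs using fun n : ℤ => BInfPos.exists_lift ((isQSystem_bInfPos r).shift (-n))
  obtain ⟨ρ, hρ⟩ := exists_action F
    (BInfPos.hom_ext (fun i => by simp [ht]) (fun j => by simp [hs]))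
    (fun m n => BInfPos.hom_ext (fun i => by simp [ht]; congr 1; ring) (fun j => by simp [hs]))
  exact ⟨ρ, fun n i => by rw [hρ, ht]; rfl, fun n j => by rw [hρ, hs]⟩

/-! ### Semidirect products -/

/-- The elements whose action matches conjugation form a subgroup, so the generator suffices. -/
theorem CInfE.map_action_eq_conj {N H : Type*} [Group N] [Group H] {e : ℕ}
    (φ : CInfE e →* MulAut N) (fn : N →* H) (fg : CInfE e →* H)
    (h : ∀ x, fn (φ (CInfE.z e) x) = fg (CInfE.z e) * fn x * (fg (CInfE.z e))⁻¹)
    (g : CInfE e) (x : N) : fn (φ g x) = fg g * fn x * (fg g)⁻¹ := by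
  let K : Subgroup (CInfE e) :=
    { carrier := {g | ∀ x, fn (φ g x) = fg g * fn x * (fg g)⁻¹}
      one_mem' := fun x => by simp
      mul_mem' := fun {a b} ha hb x => by
        rw [map_mul, MulAut.mul_apply, ha, hb, map_mul]
        group
      inv_mem' := fun {a} ha x => by
        have := ha (φ a⁻¹ x)
        rw [← MulAut.mul_apply, ← map_mul, mul_inv_cancel, map_one, MulAut.one_apply] at this
        rw [this, map_inv fg, inv_inv]
        simp only [mul_assoc, inv_mul_cancel_left, inv_mul_cancel, mul_one] }
  obtain ⟨n, rfl⟩ := CInfE.exists_eq_zpow g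
  exact K.zpow_mem (x := CInfE.z e) h n x

theorem BDeer.exists_equiv (d r : ℕ) {e : ℕ} (he : 1 ≤ e) :
    ∃ ρ : CInf →* MulAut (BInf r),
      (∀ i : ℤ, ρ CInf.c (BInf.t r i) = BInf.t r (i - 1)) ∧
      (∀ j : SIdx r, ρ CInf.c (BInf.s r j) = BInf.s r j) ∧
      ∃ ψ : BDeer d e r ≃* BInf r ⋊[ρ.comp (CInfE e).subtype] (CInfE e),
        ψ (BDeer.z d e r) = SemidirectProduct.inr (CInfE.z e) ∧
        (∀ i : ℤ, ψ (BDeer.t d e r i) = SemidirectProduct.inl (BInf.t r i)) ∧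
        ∀ j : SIdx r, ψ (BDeer.s d e r j) = SemidirectProduct.inl (BInf.s r j) := by
  obtain ⟨ρ, hρt, hρs⟩ := BInf.exists_shift r
  refine ⟨ρ, hρt 1, hρs 1, ?_⟩
  have hz : ((CInfE.z e : CInfE e) : CInf) = Multiplicative.ofAdd (e : ℤ) := by
    simpa using CInfE.coe_z_zpow e 1
  set φ := ρ.comp (CInfE e).subtype with hφ
  have hφt : ∀ i, φ (CInfE.z e) (BInf.t r i) = BInf.t r (i - e) := fun i => by
    rw [← hρt, ← hz]
    rfl
  have hφs : ∀ j, φ (CInfE.z e) (BInf.s r j) = BInf.s r j := fun j => by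
    have := hρs e j
    rwa [← hz] at this
  have hD : IsDSystem e (SemidirectProduct.inr (φ := φ) (CInfE.z e))
      (fun i => SemidirectProduct.inl (BInf.t r i))
      (fun j => SemidirectProduct.inl (BInf.s r j)) :=
    { (isQSystem_bInf r).map SemidirectProduct.inl with
      q4 := fun i => by
        rw [← hφt, SemidirectProduct.inl_aut, map_inv, inv_mul_cancel_right]
      q5 := fun j => by
        conv_rhs => rw [← hφs, SemidirectProduct.inl_aut, map_inv, inv_mul_cancel_right] }
  obtain ⟨F, hFz, hFt, hFs⟩ := BDeer.exists_lift (d := d) he hD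
  have hB := isDSystem_bDeer d r he
  obtain ⟨fn, hnt, hns⟩ := BInf.exists_lift hB.toIsQSystem
  obtain ⟨fg, hg⟩ := CInfE.exists_hom he (BDeer.z d e r)
  have hconj : fn.comp (φ (CInfE.z e)).toMonoidHom =
      (MulAut.conj (fg (CInfE.z e))).toMonoidHom.comp fn := by
    refine BInf.hom_ext (fun i => ?_) (fun j => ?_)
    · change fn (φ (CInfE.z e) _) = fg _ * fn _ * (fg _)⁻¹
      rw [hφt, hg, hnt, hnt, hB.q4, mul_inv_cancel_right]
    · change fn (φ (CInfE.z e) _) = fg _ * fn _ * (fg _)⁻¹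
      rw [hφs, hg, hns, hB.q5, mul_inv_cancel_right]
  let E : BInf r ⋊[φ] (CInfE e) →* BDeer d e r := SemidirectProduct.lift fn fg (fun g =>
    MonoidHom.ext fun x => CInfE.map_action_eq_conj φ fn fg (DFunLike.congr_fun hconj) g x)
  refine ⟨MonoidHom.toMulEquiv F E ?_ ?_, hFz, hFt, hFs⟩
  · refine BDeer.hom_ext ?_ (fun i => ?_) (fun j => ?_)
    · change E (F _) = _
      rw [hFz, SemidirectProduct.lift_inr, hg]
      rfl
    · change E (F _) = _
      rw [hFt, SemidirectProduct.lift_inl, hnt]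
      rfl
    · change E (F _) = _
      rw [hFs, SemidirectProduct.lift_inl, hns]
      rfl
  · refine SemidirectProduct.hom_ext ?_ ?_
    · refine BInf.hom_ext (fun i => ?_) (fun j => ?_)
      · change F (E (SemidirectProduct.inl _)) = _
        rw [SemidirectProduct.lift_inl, hnt, hFt]
        rfl
      · change F (E (SemidirectProduct.inl _)) = _
        rw [SemidirectProduct.lift_inl, hns, hFs]
        rfl
    · refine MonoidHom.ext fun g => ?_
      change F (E (SemidirectProduct.inr _)) = SemidirectProduct.inr _
      obtain ⟨n, rfl⟩ := CInfE.exists_eq_zpow g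
      rw [SemidirectProduct.lift_inr, map_zpow, map_zpow, map_zpow, hg, hFz]

namespace MonoidSemidirect

variable {N G : Type*} [Monoid N] [Monoid G] (φ : G →* MulAut N)

theorem mul_def (a b : MonoidSemidirect N G φ) :
    a * b = ⟨a.left * φ a.right b.left, a.right * b.right⟩ := rfl

theorem one_def : (1 : MonoidSemidirect N G φ) = ⟨1, 1⟩ := rfl

/-- The homomorphism given by `inl`. -/
def inlHom : N →* MonoidSemidirect N G φ where
  toFun := inl φ
  map_one' := rfl
  map_mul' a b := by simp [inl, mul_def]

/-- The homomorphism given by `inr`. -/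
def inrHom : G →* MonoidSemidirect N G φ where
  toFun := inr φ
  map_one' := rfl
  map_mul' a b := by simp [inr, mul_def]

theorem inr_mul_inl (g : G) (x : N) : inr φ g * inl φ x = inl φ (φ g x) * inr φ g := by
  simp [inr, inl, mul_def]

theorem mk_eq (x : N) (g : G) : (⟨x, g⟩ : MonoidSemidirect N G φ) = inl φ x * inr φ g := by
  simp [inr, inl, mul_def]

/-- The homomorphism from a semidirect product given by compatible homomorphisms. -/
def lift {H : Type*} [Monoid H] (fn : N →* H) (fg : G →* H)
    (h : ∀ g x, fg g * fn x = fn (φ g x) * fg g) : MonoidSemidirect N G φ →* H where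
  toFun a := fn a.left * fg a.right
  map_one' := by simp [one_def]
  map_mul' a b := by
    rw [mul_def, map_mul, map_mul, mul_assoc, mul_assoc, ← mul_assoc (fg a.right), h, mul_assoc]

end MonoidSemidirect

/-- The analogue of `CInfE.map_action_eq_conj` stated without inverses, as the target is only a
monoid. -/
theorem CInfEPos.mul_map_eq {N H : Type*} [Monoid N] [Monoid H] {e : ℕ}
    (φ : CInfEPos e →* MulAut N) (fn : N →* H) (fg : CInfEPos e →* H)
    (h : ∀ x, fg (CInfEPos.z e) * fn x = fn (φ (CInfEPos.z e) x) * fg (CInfEPos.z e))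
    (g : CInfEPos e) (x : N) : fg g * fn x = fn (φ g x) * fg g := by
  let K : Submonoid (CInfEPos e) :=
    { carrier := {g | ∀ x, fg g * fn x = fn (φ g x) * fg g}
      one_mem' := fun x => by simp
      mul_mem' := fun {a b} ha hb x => by
        rw [map_mul, map_mul, MulAut.mul_apply, mul_assoc, hb, ← mul_assoc, ha, mul_assoc] }
  obtain ⟨n, rfl⟩ := CInfEPos.exists_eq_pow g
  exact K.pow_mem (x := CInfEPos.z e) h n x

theorem BDeerPos.exists_equiv (r : ℕ) {e : ℕ} (he : 1 ≤ e) :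
    ∃ ρ : CInf →* MulAut (BInfPos r),
      (∀ i : ℤ, ρ CInf.c (BInfPos.t r i) = BInfPos.t r (i - 1)) ∧
      (∀ j : SIdx r, ρ CInf.c (BInfPos.s r j) = BInfPos.s r j) ∧
      ∃ ψ : BDeerPos e r ≃* MonoidSemidirect (BInfPos r) (CInfEPos e)
          ((ρ.comp (CInfE e).subtype).comp (CInfEPos e).subtype),
        ψ (BDeerPos.z e r) =
          MonoidSemidirect.inr _ ⟨CInfE.z e, Submonoid.mem_powers (CInfE.z e)⟩ ∧
        (∀ i : ℤ, ψ (BDeerPos.t e r i) = MonoidSemidirect.inl _ (BInfPos.t r i)) ∧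
        ∀ j : SIdx r, ψ (BDeerPos.s e r j) = MonoidSemidirect.inl _ (BInfPos.s r j) := by
  obtain ⟨ρ, hρt, hρs⟩ := BInfPos.exists_shift r
  refine ⟨ρ, hρt 1, hρs 1, ?_⟩
  have hz : ((CInfE.z e : CInfE e) : CInf) = Multiplicative.ofAdd (e : ℤ) := by
    simpa using CInfE.coe_z_zpow e 1
  set φ := (ρ.comp (CInfE e).subtype).comp (CInfEPos e).subtype with hφ
  have hφt : ∀ i, φ (CInfEPos.z e) (BInfPos.t r i) = BInfPos.t r (i - e) := fun i => by
    rw [← hρt, ← hz]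
    rfl
  have hφs : ∀ j, φ (CInfEPos.z e) (BInfPos.s r j) = BInfPos.s r j := fun j => by
    have := hρs e j
    rwa [← hz] at this
  have hD : IsDSystem e (MonoidSemidirect.inrHom φ (CInfEPos.z e))
      (fun i => MonoidSemidirect.inlHom φ (BInfPos.t r i))
      (fun j => MonoidSemidirect.inlHom φ (BInfPos.s r j)) :=
    { (isQSystem_bInfPos r).map (MonoidSemidirect.inlHom φ) with
      q4 := fun i => by
        rw [← hφt]
        exact MonoidSemidirect.inr_mul_inl φ _ _
      q5 := fun j => by
        conv_rhs => rw [← hφs]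
        exact MonoidSemidirect.inr_mul_inl φ _ _ }
  obtain ⟨F, hFz, hFt, hFs⟩ := BDeerPos.exists_lift hD
  have hB := isDSystem_bDeerPos e r
  obtain ⟨fn, hnt, hns⟩ := BInfPos.exists_lift hB.toIsQSystem
  obtain ⟨fg, hg⟩ := CInfEPos.exists_hom he (BDeerPos.z e r)
  have hconj : ∀ x, fg (CInfEPos.z e) * fn x = fn (φ (CInfEPos.z e) x) * fg (CInfEPos.z e) := by
    intro x
    have hx : x ∈ Submonoid.closure (Set.range (BInfPos.t r) ∪ Set.range (BInfPos.s r)) :=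
      BInfPos.closure_eq_top r ▸ Submonoid.mem_top x
    induction hx using Submonoid.closure_induction with
    | mem x hx =>
      rcases hx with ⟨i, rfl⟩ | ⟨j, rfl⟩
      · rw [hφt, hg, hnt, hnt, hB.q4]
      · rw [hφs, hg, hns, hB.q5]
    | one => simp
    | mul x y _ _ ihx ihy => rw [map_mul, ← mul_assoc, ihx, mul_assoc, ihy, map_mul, map_mul,
        mul_assoc]
  let E : MonoidSemidirect (BInfPos r) (CInfEPos e) φ →* BDeerPos e r :=
    MonoidSemidirect.lift φ fn fg (CInfEPos.mul_map_eq φ fn fg hconj)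
  have hEl : ∀ x, E (MonoidSemidirect.inl φ x) = fn x := fun x => by
    change fn x * fg 1 = fn x
    rw [map_one, mul_one]
  have hEr : ∀ g, E (MonoidSemidirect.inr φ g) = fg g := fun g => by
    change fn 1 * fg g = fg g
    rw [map_one, one_mul]
  have hFn : F.comp fn = MonoidSemidirect.inlHom φ := by
    refine BInfPos.hom_ext (fun i => ?_) (fun j => ?_)
    · rw [MonoidHom.comp_apply, hnt, hFt]
    · rw [MonoidHom.comp_apply, hns, hFs]
  have hFg : ∀ g, F (fg g) = MonoidSemidirect.inrHom φ g := fun g => by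
    obtain ⟨n, rfl⟩ := CInfEPos.exists_eq_pow g
    rw [map_pow, map_pow, hg, hFz, ← map_pow]
  refine ⟨MonoidHom.toMulEquiv F E ?_ ?_, hFz, hFt, hFs⟩
  · refine BDeerPos.hom_ext ?_ (fun i => ?_) (fun j => ?_)
    · change E (F _) = _
      rw [hFz]
      exact (hEr _).trans hg
    · change E (F _) = _
      rw [hFt]
      exact (hEl _).trans (hnt i)
    · change E (F _) = _
      rw [hFs]
      exact (hEl _).trans (hns j)
  · refine MonoidHom.ext fun a => ?_
    change F (fn a.left * fg a.right) = a
    rw [map_mul, hFg]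
    exact (congrArg (· * _) (DFunLike.congr_fun hFn a.left)).trans
      (MonoidSemidirect.mk_eq φ a.left a.right).symm

/-! ### Divisibility in `B⁺(de,e,r)` -/

namespace CInfEPos

variable {e : ℕ}

theorem exists_isRightLcm (he : 1 ≤ e) (g h : CInfEPos e) : ∃ m, IsRightLcm g h m := by
  obtain ⟨k, rfl⟩ := exists_eq_pow g
  obtain ⟨l, rfl⟩ := exists_eq_pow h
  refine ⟨z e ^ max k l, pow_dvd_pow _ (le_max_left k l), pow_dvd_pow _ (le_max_right k l), ?_⟩
  rintro _ ⟨u, rfl⟩ ⟨v, hv⟩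
  obtain ⟨m, rfl⟩ := exists_eq_pow u
  obtain ⟨n, rfl⟩ := exists_eq_pow v
  rw [← pow_add, ← pow_add] at hv
  have := pow_injective he hv
  rw [← pow_add]
  exact pow_dvd_pow _ (by omega)

end CInfEPos

namespace MonoidSemidirect

variable {N G : Type*} [Monoid N] [Monoid G] (φ : G →* MulAut N)

theorem mul_left_cancel_of (hN : ∀ a b c : N, a * b = a * c → b = c)
    (hG : ∀ a b c : G, a * b = a * c → b = c) (a b c : MonoidSemidirect N G φ)
    (h : a * b = a * c) : b = c := by
  rw [mul_def, mul_def] at h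
  injection h with h1 h2
  exact MonoidSemidirect.ext ((φ a.right).injective (hN _ _ _ h1)) (hG _ _ _ h2)

/-- The twist is by automorphisms, so any quotient in N can be untwisted. -/
theorem dvd_iff {a b : MonoidSemidirect N G φ} : a ∣ b ↔ a.left ∣ b.left ∧ a.right ∣ b.right := by
  constructor
  · rintro ⟨c, rfl⟩
    exact ⟨Dvd.intro _ rfl, Dvd.intro _ rfl⟩
  · rintro ⟨⟨x, hx⟩, ⟨g, hg⟩⟩
    refine ⟨⟨(φ a.right).symm x, g⟩, ?_⟩
    rw [mul_def, MulEquiv.apply_symm_apply, ← hx, ← hg]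

theorem exists_isRightLcm (hN : ∀ a b : N, ∃ m, IsRightLcm a b m)
    (hG : ∀ a b : G, ∃ m, IsRightLcm a b m) (a b : MonoidSemidirect N G φ) :
    ∃ m, IsRightLcm a b m := by
  obtain ⟨x, hx⟩ := hN a.left b.left
  obtain ⟨g, hg⟩ := hG a.right b.right
  refine ⟨⟨x, g⟩, (dvd_iff φ).2 ⟨hx.1, hg.1⟩, (dvd_iff φ).2 ⟨hx.2.1, hg.2.1⟩, fun n ha hb => ?_⟩
  rw [dvd_iff] at ha hb ⊢
  exact ⟨hx.2.2 _ ha.1 hb.1, hg.2.2 _ ha.2 hb.2⟩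

end MonoidSemidirect

namespace BDeerPos

variable {e r : ℕ}

theorem deerRel_length (u v : FreeMonoid (DeerGen r)) (h : DeerRel e r u v) :
    u.length = v.length := by
  rcases h with (⟨_, _, (⟨_, _, ⟨j, k, hjk⟩ | ⟨j, k, hjk⟩⟩ | ⟨i, j⟩ | ⟨j, hj, i⟩ | ⟨j, hj, i⟩)⟩ |
    i | j) <;> rfl

theorem mul_left_cancel' (he : 1 ≤ e) (a b c : BDeerPos e r) (h : a * b = a * c) : b = c := by
  obtain ⟨ρ, -, -, ψ, -⟩ := exists_equiv r he
  refine ψ.injective (MonoidSemidirect.mul_left_cancel_of _ BInfPos.mul_left_cancel'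
    (fun a b c h => ?_) (ψ a) _ _ (by rw [← map_mul, h, map_mul]))
  exact Subtype.ext (mul_left_cancel (congrArg Subtype.val h))

theorem exists_lcm (he : 1 ≤ e) (hr : 2 ≤ r) (a b : BDeerPos e r) : ∃ m, IsRightLcm a b m := by
  obtain ⟨ρ, -, -, ψ, -⟩ := exists_equiv r he
  obtain ⟨m, h1, h2, h3⟩ := MonoidSemidirect.exists_isRightLcm _ (BInfPos.exists_lcm hr)
    (CInfEPos.exists_isRightLcm he) (ψ a) (ψ b)
  refine ⟨ψ.symm m, ?_, ?_, fun n ha hb => ?_⟩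
  · simpa using map_dvd ψ.symm h1
  · simpa using map_dvd ψ.symm h2
  · simpa using map_dvd ψ.symm (h3 (ψ n) (map_dvd ψ ha) (map_dvd ψ hb))

/-- The anti-automorphism of `B⁺(de,e,r)` with `z ↦ z`, `t_i ↦ t_{-i}` and `s_j ↦ s_j`. -/
theorem exists_reverse (e r : ℕ) : ∃ f : BDeerPos e r → BDeerPos e r,
    (∀ a b, f (a * b) = f b * f a) ∧ ∀ a, f (f a) = a := by
  have h := isDSystem_bDeerPos e r
  have hop : IsDSystem e (MulOpposite.op (BDeerPos.z e r))
      (fun i => MulOpposite.op (BDeerPos.t e r (-i)))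
      (fun j => MulOpposite.op (BDeerPos.s e r j)) :=
    { comm := fun j k hjk => by simp only [← MulOpposite.op_mul, h.comm j k hjk]
      braid := fun j k hjk => by
        simp only [← MulOpposite.op_mul, ← mul_assoc, h.braid j k hjk]
      q1 := fun i j => by
        -- Reversing t_i t_{i-1} and negating indices gives t_{-(i-1)} t_{-i}, again a product of
        -- the constant form.
        have := h.q1 (-(i - 1)) (-(j - 1))
        rw [show -(i - 1) - 1 = -i by ring, show -(j - 1) - 1 = -j by ring] at this
        simp only [← MulOpposite.op_mul, this]
      q2 := fun j hj i => by simp only [← MulOpposite.op_mul, ← mul_assoc, h.q2 j hj]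
      q3 := fun j hj i => by simp only [← MulOpposite.op_mul, h.q3 j hj]
      q4 := fun i => by
        rw [← MulOpposite.op_mul, ← MulOpposite.op_mul, h.q4, show -(i - (e : ℤ)) - e = -i by ring]
      q5 := fun j => by simp only [← MulOpposite.op_mul, h.q5 j] }
  obtain ⟨F, hz, ht, hs⟩ := exists_lift hop
  refine ⟨fun x => (F x).unop, fun a b => by simp, fun x => ?_⟩
  have hx : x ∈ Submonoid.closure ({BDeerPos.z e r} ∪ (Set.range (BDeerPos.t e r) ∪
      Set.range (BDeerPos.s e r))) := closure_eq_top e r ▸ Submonoid.mem_top x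
  induction hx using Submonoid.closure_induction with
  | mem x hx =>
    rcases hx with rfl | ⟨i, rfl⟩ | ⟨j, rfl⟩
    · simp [hz]
    · simp [ht]
    · simp [hs]
  | one => simp
  | mul x y _ _ ihx ihy => simp only [map_mul, MulOpposite.unop_mul, ihx, ihy]

theorem mul_right_cancel' (he : 1 ≤ e) (a b c : BDeerPos e r) (h : b * a = c * a) : b = c := by
  obtain ⟨f, hf, hff⟩ := exists_reverse e r
  rw [← hff b, ← hff c, mul_left_cancel' he (f a) (f b) (f c) (by rw [← hf, ← hf, h])]

theorem exists_right_lattice (he : 1 ≤ e) (hr : 2 ≤ r) :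
    ∃ L : Lattice (BDeerPos e r), ∀ a b : BDeerPos e r, L.le a b ↔ RightDvd a b := by
  obtain ⟨f, hf, hff⟩ := exists_reverse e r
  obtain ⟨L, hL⟩ := (PresentedMonoid.isLength_wordLength (deerRel_length (e := e))).exists_lattice
    (exists_lcm he hr)
  refine ⟨{
    le := fun a b => L.le (f a) (f b)
    lt := fun a b => L.le (f a) (f b) ∧ ¬ L.le (f b) (f a)
    lt_iff_le_not_ge := fun a b => Iff.rfl
    le_refl := fun a => L.le_refl _
    le_trans := fun a b c => L.le_trans _ _ _
    le_antisymm := fun a b h h' => by rw [← hff a, ← hff b, L.le_antisymm _ _ h h']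
    sup := fun a b => f (L.sup (f a) (f b))
    inf := fun a b => f (L.inf (f a) (f b))
    le_sup_left := fun a b => by rw [hff]; exact L.le_sup_left _ _
    le_sup_right := fun a b => by rw [hff]; exact L.le_sup_right _ _
    sup_le := fun a b c h h' => by rw [hff]; exact L.sup_le _ _ _ h h'
    inf_le_left := fun a b => by rw [hff]; exact L.inf_le_left _ _
    inf_le_right := fun a b => by rw [hff]; exact L.inf_le_right _ _
    le_inf := fun a b c h h' => by rw [hff]; exact L.le_inf _ _ _ h h' }, fun a b => ?_⟩
  change L.le (f a) (f b) ↔ _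
  rw [hL]
  constructor
  · rintro ⟨c, hc⟩
    exact ⟨f c, by rw [← hff b, hc, hf, hff]⟩
  · rintro ⟨c, rfl⟩
    exact ⟨f c, hf c a⟩

end BDeerPos

/-! ### Groups of fractions -/

/-- Common multiples turn (ι b)⁻¹ ι c into a right fraction, so right fractions are closed under
products; left fractions are dual. -/
theorem isGroupOfFractions_of_ore {M G : Type*} [Monoid M] [Group G] {ι : M →* G}
    (hι : Function.Injective ι) (hG : Subgroup.closure (Set.range ι) = ⊤)
    (hr : ∀ x y : M, ∃ u v, x * u = y * v) (hl : ∀ x y : M, ∃ u v, u * x = v * y) :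
    IsGroupOfFractions ι where
  injective := hι
  right_fractions g := by
    have hg : g ∈ Subgroup.closure (Set.range ι) := hG ▸ Subgroup.mem_top g
    induction hg using Subgroup.closure_induction with
    | mem g hg =>
      obtain ⟨a, rfl⟩ := hg
      exact ⟨a, 1, by simp⟩
    | one => exact ⟨1, 1, by simp⟩
    | mul g h _ _ ihg ihh =>
      obtain ⟨a, b, rfl⟩ := ihg
      obtain ⟨c, d, rfl⟩ := ihh
      obtain ⟨u, v, huv⟩ := hr b c
      have key : (ι b)⁻¹ * ι c = ι u * (ι v)⁻¹ := by
        rw [inv_mul_eq_iff_eq_mul, ← mul_assoc, ← map_mul, huv, map_mul, mul_inv_cancel_right]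
      refine ⟨a * u, d * v, ?_⟩
      rw [mul_assoc, ← mul_assoc _ (ι c), key, map_mul, map_mul, mul_inv_rev]
      simp only [mul_assoc]
    | inv g _ ih =>
      obtain ⟨a, b, rfl⟩ := ih
      exact ⟨b, a, by simp⟩
  left_fractions g := by
    have hg : g ∈ Subgroup.closure (Set.range ι) := hG ▸ Subgroup.mem_top g
    induction hg using Subgroup.closure_induction with
    | mem g hg =>
      obtain ⟨a, rfl⟩ := hg
      exact ⟨1, a, by simp⟩
    | one => exact ⟨1, 1, by simp⟩
    | mul g h _ _ ihg ihh =>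
      obtain ⟨a, b, rfl⟩ := ihg
      obtain ⟨c, d, rfl⟩ := ihh
      obtain ⟨u, v, huv⟩ := hl b c
      have key : ι b * (ι c)⁻¹ = (ι u)⁻¹ * ι v := by
        rw [mul_inv_eq_iff_eq_mul, mul_assoc, ← map_mul, ← huv, map_mul, inv_mul_cancel_left]
      refine ⟨u * a, v * d, ?_⟩
      rw [mul_assoc, ← mul_assoc (ι b), key, map_mul, map_mul, mul_inv_rev]
      simp only [mul_assoc]
    | inv g _ ih =>
      obtain ⟨a, b, rfl⟩ := ih
      exact ⟨b, a, by simp⟩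

/-- Ore's theorem. -/
theorem exists_injective_hom_of_ore {M : Type} [Monoid M]
    (hcl : ∀ a b c : M, a * b = a * c → b = c) (hcr : ∀ a b c : M, b * a = c * a → b = c)
    (hl : ∀ x y : M, ∃ u v, u * x = v * y) :
    ∃ (G : Type) (_ : Group G) (f : M →* G), Function.Injective f := by
  choose u v huv using hl
  let _ : OreLocalization.OreSet (⊤ : Submonoid M) :=
    { ore_right_cancel := fun a b s h => ⟨1, by rw [hcr s a b h]⟩
      oreNum := fun x s => v x s
      oreDenom := fun x s => ⟨u x s, Submonoid.mem_top _⟩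
      ore_eq := fun x s => huv x s }
  let L := OreLocalization (⊤ : Submonoid M) M
  -- All elements are inverted in the localization, so the map lands in its unit group.
  let f : M →* Lˣ :=
    { toFun := fun x => OreLocalization.numeratorUnit ⟨x, Submonoid.mem_top x⟩
      map_one' := Units.ext (map_one (OreLocalization.numeratorHom (S := (⊤ : Submonoid M))))
      map_mul' := fun x y =>
        Units.ext (map_mul (OreLocalization.numeratorHom (S := (⊤ : Submonoid M))) x y) }
  refine ⟨Lˣ, inferInstance, f, fun x y hxy => ?_⟩
  have h : (OreLocalization.numeratorHom x : L) = OreLocalization.numeratorHom y :=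
    congrArg Units.val hxy
  rw [OreLocalization.numeratorHom_apply, OreLocalization.numeratorHom_apply,
    OreLocalization.oreDiv_eq_iff] at h
  obtain ⟨a, b, h1, h2⟩ := h
  rw [OneMemClass.coe_one, mul_one, mul_one] at h2
  subst h2
  exact (hcl _ _ _ h1).symm

namespace BDeerPos

variable {e r : ℕ}

theorem exists_common_right (he : 1 ≤ e) (hr : 2 ≤ r) (x y : BDeerPos e r) :
    ∃ u v, x * u = y * v := by
  obtain ⟨m, ⟨u, hu⟩, ⟨v, hv⟩, -⟩ := exists_lcm he hr x y
  exact ⟨u, v, by rw [← hu, hv]⟩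

theorem exists_common_left (he : 1 ≤ e) (hr : 2 ≤ r) (x y : BDeerPos e r) :
    ∃ u v, u * x = v * y := by
  obtain ⟨f, hf, hff⟩ := exists_reverse e r
  obtain ⟨u, v, h⟩ := exists_common_right he hr (f x) (f y)
  exact ⟨f u, f v, by rw [← hff x, ← hf, h, hf, hff y]⟩

/-- Injectivity comes from the universal property: an embedding of the monoid in any group factors
through ι. -/
theorem isGroupOfFractions (d : ℕ) (he : 1 ≤ e) (hr : 2 ≤ r) {ι : BDeerPos e r →* BDeer d e r}
    (hz : ι (BDeerPos.z e r) = BDeer.z d e r)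
    (ht : ∀ i : ℤ, ι (BDeerPos.t e r i) = BDeer.t d e r i)
    (hs : ∀ j : SIdx r, ι (BDeerPos.s e r j) = BDeer.s d e r j) : IsGroupOfFractions ι := by
  refine isGroupOfFractions_of_ore ?_ ?_ (exists_common_right he hr) (exists_common_left he hr)
  · obtain ⟨G, _, f, hf⟩ := exists_injective_hom_of_ore (mul_left_cancel' he)
      (mul_right_cancel' he) (exists_common_left he hr)
    obtain ⟨F, hFz, hFt, hFs⟩ :=
      BDeer.exists_lift (d := d) he ((isDSystem_bDeerPos e r).map f)
    have key : F.comp ι = f := BDeerPos.hom_ext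
      (by rw [MonoidHom.comp_apply, hz, hFz])
      (fun i => by rw [MonoidHom.comp_apply, ht, hFt])
      (fun j => by rw [MonoidHom.comp_apply, hs, hFs])
    have hinj : Function.Injective (F ∘ ι) := by
      rw [← MonoidHom.coe_comp, key]
      exact hf
    exact hinj.of_comp
  · refine top_unique fun g _ => PresentedGroup.generated_by _ _ ?_ g
    rintro (_ | _ | _ | j)
    · exact Subgroup.subset_closure ⟨_, hz⟩
    · exact Subgroup.subset_closure ⟨_, (ht 0).trans (tSeq_zero _ _)⟩
    · exact Subgroup.subset_closure ⟨_, (ht 1).trans (tSeq_one _ _)⟩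
    · exact Subgroup.subset_closure ⟨_, hs j⟩

theorem isGarsideElement (he : 1 ≤ e) (hr : 2 ≤ r) {p q : ℕ} (hp : 0 < p) (hq : 0 < q) :
    IsGarsideElement (BDeerPos.z e r ^ p * BDeerPos.Lam e r ^ q) :=
  (isQuasiCentral e hr p q).isGarsideElement (mul_left_cancel' he) (mul_right_cancel' he)
    (closure_eq_top e r) (dvd_garside e hr hp hq)

theorem isQuasiGarsideMonoid (he : 1 ≤ e) (hr : 2 ≤ r) : IsQuasiGarsideMonoid (BDeerPos e r) where
  atomic := (PresentedMonoid.isLength_wordLength deerRel_length).isAtomicMonoid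
  mul_left_cancel := mul_left_cancel' he
  mul_right_cancel := mul_right_cancel' he
  left_lattice := (PresentedMonoid.isLength_wordLength deerRel_length).exists_lattice
    (exists_lcm he hr)
  right_lattice := exists_right_lattice he hr
  exists_garside := ⟨_, isGarsideElement he hr one_pos one_pos⟩

end BDeerPos

theorem mainTheorem4 (d e r : ℕ) (hd : 2 ≤ d) (he : 1 ≤ e) (hr : 2 ≤ r) :
    -- the new presentation is a presentation of `B(de,e,r)`
    (∃ θ : PosGroup (DeerRel e r) ≃* BDeer d e r,
      θ (PosGroup.gen _ DeerGen.z) = BDeer.z d e r ∧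
      (∀ i : ℤ, θ (PosGroup.gen _ (DeerGen.t i)) = BDeer.t d e r i) ∧
      ∀ j : SIdx r, θ (PosGroup.gen _ (DeerGen.s j)) = BDeer.s d e r j) ∧
    -- `C_∞` acts on `B(∞,∞,r)`, and `B(de,e,r) ≅ C_∞^e ⋉ B(∞,∞,r)`
    (∃ ρ : CInf →* MulAut (BInf r),
      (∀ i : ℤ, ρ CInf.c (BInf.t r i) = BInf.t r (i - 1)) ∧
      (∀ j : SIdx r, ρ CInf.c (BInf.s r j) = BInf.s r j) ∧
      ∃ ψ : BDeer d e r ≃* BInf r ⋊[ρ.comp (CInfE e).subtype] (CInfE e),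
        ψ (BDeer.z d e r) = SemidirectProduct.inr (CInfE.z e) ∧
        (∀ i : ℤ, ψ (BDeer.t d e r i) = SemidirectProduct.inl (BInf.t r i)) ∧
        ∀ j : SIdx r, ψ (BDeer.s d e r j) = SemidirectProduct.inl (BInf.s r j)) ∧
    -- `C_∞` acts on `B⁺(∞,∞,r)`, and `B⁺(de,e,r) ≅ (C_∞^e)⁺ ⋉ B⁺(∞,∞,r)`
    (∃ ρ : CInf →* MulAut (BInfPos r),
      (∀ i : ℤ, ρ CInf.c (BInfPos.t r i) = BInfPos.t r (i - 1)) ∧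
      (∀ j : SIdx r, ρ CInf.c (BInfPos.s r j) = BInfPos.s r j) ∧
      ∃ ψ : BDeerPos e r ≃* MonoidSemidirect (BInfPos r) (CInfEPos e)
          ((ρ.comp (CInfE e).subtype).comp (CInfEPos e).subtype),
        ψ (BDeerPos.z e r) =
          MonoidSemidirect.inr _ ⟨CInfE.z e, Submonoid.mem_powers (CInfE.z e)⟩ ∧
        (∀ i : ℤ, ψ (BDeerPos.t e r i) = MonoidSemidirect.inl _ (BInfPos.t r i)) ∧
        ∀ j : SIdx r, ψ (BDeerPos.s e r j) = MonoidSemidirect.inl _ (BInfPos.s r j)) ∧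
    -- `(B⁺(de,e,r), z^p Λ^q)` is a quasi-Garside structure on `B(de,e,r)`
    (∃ ι : BDeerPos e r →* BDeer d e r,
      ι (BDeerPos.z e r) = BDeer.z d e r ∧
      (∀ i : ℤ, ι (BDeerPos.t e r i) = BDeer.t d e r i) ∧
      (∀ j : SIdx r, ι (BDeerPos.s e r j) = BDeer.s d e r j) ∧
      ∀ p q : ℕ, 0 < p → 0 < q →
        IsQuasiGarsideStructure ι (BDeerPos.z e r ^ p * BDeerPos.Lam e r ^ q)) := by
  refine ⟨exists_equiv_posGroup d r he, BDeer.exists_equiv d r he, BDeerPos.exists_equiv r he, ?_⟩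
  obtain ⟨ι, hz, ht, hs⟩ := BDeerPos.exists_lift (isDSystem_bDeer d r he)
  exact ⟨ι, hz, ht, hs, fun p q hp hq => ⟨BDeerPos.isQuasiGarsideMonoid he hr,
    BDeerPos.isGarsideElement he hr hp hq, BDeerPos.isGroupOfFractions d he hr hz ht hs⟩⟩
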